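/- Let $\alpha>0$, and let $l_n(x)=L_n(x)e^{-x/2}$ ($x\in\mathbb R_+=(0,\infty)$) and $h_n$ ($n\in\mathbb N_0$) be the Laguerre and Hermite functions. Let $\mathcal G_\alpha(\mathbb R_+)$ (resp. $\mathcal G_{0,\alpha}(\mathbb R_+)$) be the space of all $\varphi=\sum_n a_nl_n$ with $\sup_n|a_n|e^{rn^{1/\alpha}}<\infty$ for some (resp. every) $r>0$, and let $\mathcal H_{\alpha/2}(\mathbb R)$ (resp. $\mathcal H_{0,\alpha/2}(\mathbb R)$) be the space of all $\psi=\sum_n b_nh_n$ with $\sup_n|b_n|e^{rn^{1/\alpha}}<\infty$ for some (resp. every) $r>0$, with the inductive (resp. projective) limit topologies of the corresponding Banach spaces. Let $\mathcal H_{\alpha/2,even}(\mathbb R)$ and $\mathcal H_{0,\alpha/2,even}(\mathbb R)$ be the subspaces of even functions, with the subspace topology. A prime on a space denotes the strong dual, and a prime on an operator its transpose. The change of variables $(\mathcal J\psi)(x)=\psi(\sqrt x)$ is a topological isomorphism $\mathcal H_{\alpha/2,even}(\mathbb R)\to\mathcal G_\alpha(\mathbb R_+)$, so that $\mathcal J':\mathcal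 G'_\alpha(\mathbb R_+)\to\mathcal H'_{\alpha/2,even}(\mathbb R)$ is a topological isomorphism. Let $\rho\in\mathbb C\setminus\{0\}$, $c\in\mathbb C$. The operators $$E_{\rho,c}\varphi=-\rho\Big(x\varphi''+\varphi'-\frac x4\varphi+\frac12\varphi\Big)+c\varphi,\qquad J_{\rho,c}w=-\frac\rho4\Big(w''+\frac{w'}r-r^2w\Big)-\Big(\frac\rho2-c\Big)w$$ (where $w'(r)/r$ is read as $w''(0)$ at $r=0$) are continuous on $\mathcal G_\alpha(\mathbb R_+)$ and on $\mathcal H_{\alpha/2,even}(\mathbb R)$, respectively. On $\mathcal G'_\alpha(\mathbb R_+)$ the operator $E_{\rho,c}$ acts by duality, $\langle E_{\rho,c}f,\varphi\rangle=\langle f,E_{\rho,c}\varphi\rangle$; it satisfies $\langle E_{\rho,c}f,l_n\rangle=(\rho n+c)\langle f,l_n\rangle$ for all $n$. Let $T>0$. 1. If a family $u(t,\cdot)\in\mathcal G'_\alpha(\mathbb R_+)$, $t\in[0,T]$, solves $$i\partial_tu-E_{\rho,c}u=0\ \text{ on }[0,T],\qquad u(0,\cdot)=f\in\mathcal G'_\alpha(\mathbb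 R_+),$$ then $v(t,\cdot)=\mathcal J'u(t,\cdot)$ solves $$i\partial_tv-J'_{\rho,c}v=0\ \text{ on }[0,T],\qquad v(0,\cdot)=g,$$ with $g=\mathcal J'f\in\mathcal H'_{\alpha/2,even}(\mathbb R)$. 2. Conversely, if a family $v(t,\cdot)\in\mathcal H'_{\alpha/2,even}(\mathbb R)$, $t\in[0,T]$, solves the second problem with initial datum $g\in\mathcal H'_{\alpha/2,even}(\mathbb R)$, then $u(t,\cdot)=(\mathcal J')^{-1}v(t,\cdot)$ solves the first problem with initial datum $f=(\mathcal J')^{-1}g\in\mathcal G'_\alpha(\mathbb R_+)$. Here $\partial_t$ is the limit of difference quotients in the strong dual, one-sided at $t=0$ and $t=T$. All of this holds as well in the Beurling case, that is, with $\mathcal G_{0,\alpha}$ and $\mathcal H_{0,\alpha/2,even}$ in place of $\mathcal G_\alpha$ and $\mathcal H_{\alpha/2,even}$. -/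

import Mathlib

open Set Filter Topology

noncomputable section

namespace LaguerreCauchy

/-! ### Laguerre and Hermite functions -/

/-- The Laguerre polynomial `L_n(x) = (e^x / n!) (d/dx)^n (e^{-x} x^n)`. -/
def laguerrePoly (n : ℕ) (x : ℝ) : ℝ :=
  Real.exp x / (n.factorial : ℝ) * iteratedDeriv n (fun y : ℝ => Real.exp (-y) * y ^ n) x

/-- The Laguerre function `l_n(x) = L_n(x) e^{-x/2}` on `ℝ₊ = (0, ∞)`. -/
def laguerreFun (n : ℕ) (x : Ioi (0 : ℝ)) : ℂ :=
  ((laguerrePoly n x * Real.exp (-(x : ℝ) / 2) : ℝ) : ℂ)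

/-- The (physicists') Hermite polynomial `H_n(x) = (-1)^n e^{x²} (d/dx)^n e^{-x²}`. -/
def hermitePoly (n : ℕ) (x : ℝ) : ℝ :=
  (-1) ^ n * Real.exp (x ^ 2) * iteratedDeriv n (fun y : ℝ => Real.exp (-y ^ 2)) x

/-- The Hermite function `h_n(x) = (2^n n! √π)^{-1/2} e^{-x²/2} H_n(x)` on `ℝ`. -/
def hermiteFun (n : ℕ) (x : ℝ) : ℂ :=
  (((Real.sqrt (2 ^ n * (n.factorial : ℝ) * Real.sqrt Real.pi))⁻¹ *
    Real.exp (-x ^ 2 / 2) * hermitePoly n x : ℝ) : ℂ)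

/-! ### Weighted sequence spaces and the spaces of expansions -/

/-- Roumieu type (`ℓ_s`, union over the weights) or Beurling type (`ℓ_{0,s}`, intersection over
the weights). -/
inductive Kind : Type
  | roumieu : Kind
  | beurling : Kind

/-- The weight `ϑ_{r,s}(n) = e^{r n^{1/(2s)}}`. -/
def weight (r s : ℝ) (n : ℕ) : ℝ :=
  Real.exp (r * (n : ℝ) ^ (1 / (2 * s)))

/-- `|a_n| ϑ_{r,s}(n) ≤ M` for all `n`: the sequence `a` has norm at most `M` in the Banach space
of sequences weighted by `ϑ_{r,s}`. -/
def WeightedBound (r s M : ℝ) (a : ℕ → ℂ) : Prop :=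
  ∀ n, ‖a n‖ * weight r s n ≤ M

/-- The sequence spaces `ℓ_s = ⋃_{r>0} ℓ^∞_{[ϑ_{r,s}]}` and
`ℓ_{0,s} = ⋂_{r>0} ℓ^∞_{[ϑ_{r,s}]}`. -/
def MemEll (k : Kind) (s : ℝ) (a : ℕ → ℂ) : Prop :=
  match k with
  | .roumieu => ∃ r : ℝ, 0 < r ∧ ∃ M : ℝ, WeightedBound r s M a
  | .beurling => ∀ r : ℝ, 0 < r → ∃ M : ℝ, WeightedBound r s M a

lemma weight_pos (r s : ℝ) (n : ℕ) : 0 < weight r s n := Real.exp_pos _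

lemma weight_mono {r r' : ℝ} (h : r ≤ r') (s : ℝ) (n : ℕ) : weight r s n ≤ weight r' s n := by
  unfold weight
  gcongr

lemma WeightedBound.add {r s M M' : ℝ} {a b : ℕ → ℂ} (ha : WeightedBound r s M a)
    (hb : WeightedBound r s M' b) : WeightedBound r s (M + M') (a + b) := fun n => by
  have h : ‖(a + b) n‖ ≤ ‖a n‖ + ‖b n‖ := norm_add_le _ _
  have := mul_le_mul_of_nonneg_right h (weight_pos r s n).le
  linarith [ha n, hb n]

lemma WeightedBound.smul {r s M : ℝ} {a : ℕ → ℂ} (ha : WeightedBound r s M a) (c : ℂ) :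
    WeightedBound r s (‖c‖ * M) (c • a) := fun n => by
  have h : ‖(c • a) n‖ = ‖c‖ * ‖a n‖ := by simp
  rw [h, mul_assoc]
  exact mul_le_mul_of_nonneg_left (ha n) (norm_nonneg c)

lemma WeightedBound.mono {r r' s M : ℝ} {a : ℕ → ℂ} (ha : WeightedBound r' s M a)
    (h : r ≤ r') : WeightedBound r s M a := fun n =>
  (mul_le_mul_of_nonneg_left (weight_mono h s n) (norm_nonneg _)).trans (ha n)

lemma weightedBound_zero (r s : ℝ) : WeightedBound r s 0 0 := fun n => by simp

lemma MemEll.add {k : Kind} {s : ℝ} {a b : ℕ → ℂ} (ha : MemEll k s a) (hb : MemEll k s b) :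
    MemEll k s (a + b) := by
  cases k with
  | roumieu =>
    obtain ⟨r, hr, M, hM⟩ := ha
    obtain ⟨r', hr', M', hM'⟩ := hb
    exact ⟨min r r', lt_min hr hr', M + M',
      (hM.mono (min_le_left _ _)).add (hM'.mono (min_le_right _ _))⟩
  | beurling =>
    intro r hr
    obtain ⟨M, hM⟩ := ha r hr
    obtain ⟨M', hM'⟩ := hb r hr
    exact ⟨M + M', hM.add hM'⟩

lemma MemEll.smul {k : Kind} {s : ℝ} {a : ℕ → ℂ} (ha : MemEll k s a) (c : ℂ) :
    MemEll k s (c • a) := by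
  cases k with
  | roumieu =>
    obtain ⟨r, hr, M, hM⟩ := ha
    exact ⟨r, hr, _, hM.smul c⟩
  | beurling =>
    intro r hr
    obtain ⟨M, hM⟩ := ha r hr
    exact ⟨_, hM.smul c⟩

lemma memEll_zero (k : Kind) (s : ℝ) : MemEll k s 0 := by
  cases k with
  | roumieu => exact ⟨1, one_pos, 0, weightedBound_zero _ _⟩
  | beurling => exact fun r _ => ⟨0, weightedBound_zero _ _⟩

/-- The functions `f = ∑ a_n e_n` on `X` (pointwise convergent expansions in the system `e`)
whose coefficient sequence lies in `ℓ_s` or `ℓ_{0,s}`. -/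
def expansionSubmodule {X : Type} (e : ℕ → X → ℂ) (k : Kind) (s : ℝ) : Submodule ℂ (X → ℂ) where
  carrier := {f | ∃ a : ℕ → ℂ, MemEll k s a ∧ ∀ x, HasSum (fun n => a n * e n x) (f x)}
  add_mem' := by
    rintro f g ⟨a, ha, hf⟩ ⟨b, hb, hg⟩
    refine ⟨a + b, ha.add hb, fun x => ?_⟩
    simpa [add_mul] using (hf x).add (hg x)
  zero_mem' := ⟨0, memEll_zero k s, fun x => by simp⟩
  smul_mem' := by
    rintro c f ⟨a, ha, hf⟩
    refine ⟨c • a, ha.smul c, fun x => ?_⟩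
    simpa [mul_assoc] using (hf x).mul_left c

/-- The space of expansions as a type of its own: it carries the topology inherited from the
sequence space, not the topology of pointwise convergence. -/
def ExpansionSpace {X : Type} (e : ℕ → X → ℂ) (k : Kind) (s : ℝ) : Type :=
  ↥(expansionSubmodule e k s)

section Topology

variable {X : Type} (e : ℕ → X → ℂ) (k : Kind) (s : ℝ)

instance : AddCommGroup (ExpansionSpace e k s) :=
  inferInstanceAs (AddCommGroup ↥(expansionSubmodule e k s))

instance : Module ℂ (ExpansionSpace e k s) :=
  inferInstanceAs (Module ℂ ↥(expansionSubmodule e k s))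

instance : CoeFun (ExpansionSpace e k s) (fun _ => X → ℂ) :=
  ⟨fun f => f.1⟩

/-- `f = ∑ a_n e_n` with `|a_n| ϑ_{r,s}(n) ≤ M` for all `n`: the norm of `f` in the Banach space
of index `r` is at most `M`. -/
def StepBound {e : ℕ → X → ℂ} {k : Kind} {s : ℝ} (r M : ℝ) (f : ExpansionSpace e k s) : Prop :=
  ∃ a : ℕ → ℂ, WeightedBound r s M a ∧ ∀ x, HasSum (fun n => a n * e n x) (f x)

/-- The continuous seminorms. In the Roumieu case the topology is the (locally convex) inductive
limit topology of the Banach spaces of index `r > 0`, whose continuous seminorms are those that are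
bounded by a multiple of the norm on each of these spaces. In the Beurling case it is the
projective limit topology, whose continuous seminorms are those that are bounded by a multiple of
one of the (increasing in `r`) norms. -/
def IsAdmissible {e : ℕ → X → ℂ} {k : Kind} {s : ℝ} (p : Seminorm ℂ (ExpansionSpace e k s)) :
    Prop :=
  match k with
  | .roumieu => ∀ r : ℝ, 0 < r → ∃ C : ℝ, ∀ f M, StepBound r M f → p f ≤ C * M
  | .beurling => ∃ r : ℝ, 0 < r ∧ ∃ C : ℝ, ∀ f M, StepBound r M f → p f ≤ C * M

lemma isAdmissible_zero : IsAdmissible (0 : Seminorm ℂ (ExpansionSpace e k s)) := by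
  cases k with
  | roumieu => exact fun r _ => ⟨0, fun f M _ => by simp⟩
  | beurling => exact ⟨1, one_pos, 0, fun f M _ => by simp⟩

instance : Nonempty {p : Seminorm ℂ (ExpansionSpace e k s) // IsAdmissible p} :=
  ⟨⟨0, isAdmissible_zero e k s⟩⟩

/-- The family of all admissible seminorms. -/
def seminormFamily : SeminormFamily ℂ (ExpansionSpace e k s)
    {p : Seminorm ℂ (ExpansionSpace e k s) // IsAdmissible p} :=
  fun p => p.1

/-- The locally convex topology generated by the admissible seminorms. -/
instance : TopologicalSpace (ExpansionSpace e k s) :=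
  (seminormFamily e k s).moduleFilterBasis.topology

lemma withSeminorms : WithSeminorms (seminormFamily e k s) := ⟨rfl⟩

instance : IsTopologicalAddGroup (ExpansionSpace e k s) :=
  (withSeminorms e k s).topologicalAddGroup

instance : ContinuousSMul ℂ (ExpansionSpace e k s) :=
  (withSeminorms e k s).continuousSMul

end Topology

/-- `𝒢_α(ℝ₊)` (Roumieu) and `𝒢_{0,α}(ℝ₊)` (Beurling): Laguerre expansions with coefficients in
`ℓ_{α/2}`, respectively `ℓ_{0,α/2}`. -/
abbrev LaguerreSpace (k : Kind) (α : ℝ) : Type := ExpansionSpace laguerreFun k (α / 2)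

lemma memEll_single (k : Kind) (s : ℝ) (n : ℕ) : MemEll k s (Pi.single n 1) := by
  have key : ∀ r : ℝ, WeightedBound r s (weight r s n) (Pi.single n 1) := by
    intro r m
    by_cases h : m = n
    · subst h; simp
    · simpa [Pi.single_apply, h] using (weight_pos r s n).le
  cases k with
  | roumieu => exact ⟨1, one_pos, _, key 1⟩
  | beurling => exact fun r _ => ⟨_, key r⟩

/-- The Laguerre function `l_n` as a test function. -/
def laguerreElement (k : Kind) (α : ℝ) (n : ℕ) : LaguerreSpace k α :=
  ⟨laguerreFun n, Pi.single n 1, memEll_single k (α / 2) n, fun x => by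
    convert hasSum_single n (f := fun m => (Pi.single n 1 : ℕ → ℂ) m * laguerreFun m x) ?_ using 1
    · simp
    · intro m hm
      simp [Pi.single_apply, hm]⟩

/-- `ℋ_β(ℝ)` (Roumieu) and `ℋ_{0,β}(ℝ)` (Beurling): Hermite expansions with coefficients in
`ℓ_β`, respectively `ℓ_{0,β}`. -/
abbrev HermiteSpace (k : Kind) (β : ℝ) : Type := ExpansionSpace hermiteFun k β

/-- The subspace of even functions of `ℋ_β(ℝ)`, respectively `ℋ_{0,β}(ℝ)`; as a type it carries
the subspace topology. -/
def evenHermite (k : Kind) (β : ℝ) : Submodule ℂ (HermiteSpace k β) where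
  carrier := {ψ | ∀ x : ℝ, ψ (-x) = ψ x}
  add_mem' := by
    intro f g hf hg x
    change f.1 (-x) + g.1 (-x) = f.1 x + g.1 x
    rw [hf x, hg x]
  zero_mem' := fun _ => rfl
  smul_mem' := by
    intro c f hf x
    change c * f.1 (-x) = c * f.1 x
    rw [hf x]

/-- `ℋ_{β,even}(ℝ)`, respectively `ℋ_{0,β,even}(ℝ)`. -/
abbrev EvenHermiteSpace (k : Kind) (β : ℝ) : Type := ↥(evenHermite k β)

/-! ### The operators

The elements of all the spaces above are smooth functions, so `deriv` has its usual meaning. -/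

/-- Extension by zero of a function on `(0, ∞)` to `ℝ`; only used to differentiate at points of
`(0, ∞)`. -/
def extendZero (φ : Ioi (0 : ℝ) → ℂ) : ℝ → ℂ :=
  Function.extend (Subtype.val : Ioi (0 : ℝ) → ℝ) φ 0

/-- `E_{ρ,c} φ = ρ E φ + c φ`, with the Laguerre operator
`E φ = -(x φ'' + φ' - (x/4) φ + (1/2) φ)`. -/
def laguerreOp (ρ c : ℂ) (φ : Ioi (0 : ℝ) → ℂ) (x : Ioi (0 : ℝ)) : ℂ :=
  ρ * -(((x : ℝ) : ℂ) * deriv (deriv (extendZero φ)) x + deriv (extendZero φ) x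
      - ((x : ℝ) : ℂ) / 4 * φ x + 1 / 2 * φ x) + c * φ x

/-- `J_{ρ,c} w = -(ρ/4) (w'' + w'/r - r² w) - (ρ/2 - c) w`. At `r = 0` the quotient `w'(r)/r` is
read as its limit, which is `w''(0)` for an even smooth function `w`. -/
def radialOp (ρ c : ℂ) (w : ℝ → ℂ) (r : ℝ) : ℂ :=
  -(ρ / 4) * (deriv (deriv w) r + (if r = 0 then deriv (deriv w) 0 else deriv w r / (r : ℂ))
      - (r : ℂ) ^ 2 * w r) - (ρ / 2 - c) * w r

variable {k : Kind} {α β : ℝ}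

/-- `A` is the operator `E_{ρ,c}` on the test space `𝒢_α(ℝ₊)` or `𝒢_{0,α}(ℝ₊)`. -/
def IsLaguerreOp (ρ c : ℂ) (A : LaguerreSpace k α →L[ℂ] LaguerreSpace k α) : Prop :=
  ∀ (φ : LaguerreSpace k α) (x : Ioi (0 : ℝ)), (A φ) x = laguerreOp ρ c φ x

/-- `B` is the operator `J_{ρ,c}` on the test space `ℋ_{β,even}(ℝ)` or `ℋ_{0,β,even}(ℝ)`. -/
def IsRadialOp (ρ c : ℂ) (B : EvenHermiteSpace k β →L[ℂ] EvenHermiteSpace k β) : Prop :=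
  ∀ (ψ : EvenHermiteSpace k β) (r : ℝ), (B ψ).1 r = radialOp ρ c ψ.1 r

/-- `𝒥` is the change of variables `(𝒥 ψ)(x) = ψ(√x)`, `x > 0`. -/
def IsSqrtChange (𝒥 : EvenHermiteSpace k β ≃L[ℂ] LaguerreSpace k α) : Prop :=
  ∀ (ψ : EvenHermiteSpace k β) (x : Ioi (0 : ℝ)), (𝒥 ψ) x = ψ.1 (Real.sqrt x)

/-! ### Transposes and the Cauchy problem

`StrongDual ℂ E` carries the strong topology (uniform convergence on bounded sets). -/

/-- The transpose `A' : F' → E'`, `⟨A' f, φ⟩ = ⟨f, A φ⟩`, of a continuous linear map `A : E → F`,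
as a continuous linear map of the strong duals. -/
def transpose {E F : Type} [AddCommGroup E] [Module ℂ E] [TopologicalSpace E]
    [AddCommGroup F] [Module ℂ F] [TopologicalSpace F] (A : E →L[ℂ] F) :
    StrongDual ℂ F →L[ℂ] StrongDual ℂ E :=
  ContinuousLinearMap.precomp ℂ A

/-- The transpose `𝒥' : F' → E'`, `⟨𝒥' f, φ⟩ = ⟨f, 𝒥 φ⟩`, of a topological isomorphism
`𝒥 : E → F`, as a topological isomorphism of the strong duals. -/
def transposeEquiv {E F : Type} [AddCommGroup E] [Module ℂ E] [TopologicalSpace E]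
    [AddCommGroup F] [Module ℂ F] [TopologicalSpace F] (𝒥 : E ≃L[ℂ] F) :
    StrongDual ℂ F ≃L[ℂ] StrongDual ℂ E :=
  𝒥.symm.arrowCongr (ContinuousLinearEquiv.refl ℂ ℂ)

lemma transpose_apply {E F : Type} [AddCommGroup E] [Module ℂ E] [TopologicalSpace E]
    [AddCommGroup F] [Module ℂ F] [TopologicalSpace F] (A : E →L[ℂ] F) (f : StrongDual ℂ F)
    (φ : E) : transpose A f φ = f (A φ) := rfl

lemma transposeEquiv_apply {E F : Type} [AddCommGroup E] [Module ℂ E] [TopologicalSpace E]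
    [AddCommGroup F] [Module ℂ F] [TopologicalSpace F] (𝒥 : E ≃L[ℂ] F) (f : StrongDual ℂ F)
    (φ : E) : transposeEquiv 𝒥 f φ = f (𝒥 φ) := rfl

/-- The family `u(t)`, `t ∈ [0,T]`, in the topological vector space `V` solves the Cauchy problem
`i ∂_t u - L u = 0` on `[0,T]`, `u(0) = f`. The derivative is the limit of the difference quotients
in `V` (one-sided at the end points). -/
def SolvesCauchy {V : Type} [AddCommGroup V] [Module ℂ V] [TopologicalSpace V]
    (T : ℝ) (L : V → V) (u : ℝ → V) (f : V) : Prop :=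
  u 0 = f ∧
  ∀ t ∈ Icc (0 : ℝ) T, ∃ u' : V,
    Tendsto (fun τ : ℝ => ((τ - t : ℝ) : ℂ)⁻¹ • (u τ - u t)) (𝓝[Icc 0 T \ {t}] t) (𝓝 u') ∧
    Complex.I • u' - L (u t) = 0

end LaguerreCauchy

end

open LaguerreCauchy

open scoped ContDiff

noncomputable section

namespace LaguerreCauchy

/-! ### Recurrences for Laguerre polynomials -/

/-! The Cauchy problem itself is soft. The transpose 𝒥' is a topological isomorphism of the strong
duals, and 𝒥 A = ... = B conjugated by 𝒥, so 𝒥' and its inverse carry difference quotients, their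
limits and the equation from one side to the other (`transposeEquiv_intertwines`,
`SolvesCauchy.map`). The work lies in showing that 𝒥, E and J exist as continuous maps on the test
spaces and that they intertwine.

For 𝒥 the key is the pair of generating functions ∑ L_m(x) t^m = (1-t)^{-1} e^{-xt/(1-t)} and ∑
(-1)^m H_{2m}(y)/(4^m m!) t^m = (1-t)^{-1/2} e^{-y²t/(1-t)}. At x = y² they differ by the factor
(1-t)^{±1/2}, so each system is a convolution of the other with a bounded sequence
(`laguerrePoly_sq_eq`, `evenHermitePoly_eq`). On coefficients this becomes the transposed sum ∑_j
c_j a_{j+k}. Like multiplication by a polynomially bounded sequence and reindexing by 2n, it only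
shrinks the index r by a fixed factor (`IsTransfer`), which treats the Roumieu and Beurling cases
together.

The operator E multiplies the n-th Laguerre coefficient by ρn + c. Termwise differentiation
(`hasSum_laguerreOp`) is justified by bounds for L_n and its derivatives that are locally uniform in
x and polynomial in n. The same computation in the variable r² gives J (`hasSum_radialOp`).

All maps are defined on functions and coefficients serve only for estimates, so neither
orthogonality nor uniqueness of the expansions is needed. -/

lemma iteratedDeriv_succ_id_mul {f : ℝ → ℝ} (hf : ContDiff ℝ ∞ f) (n : ℕ) (x : ℝ) :
    iteratedDeriv (n + 1) (fun y => y * f y) x =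
      x * iteratedDeriv (n + 1) f x + (n + 1) * iteratedDeriv n f x := by
  have hd : ∀ m x, HasDerivAt (iteratedDeriv m f) (iteratedDeriv (m + 1) f x) x := by
    intro m x
    rw [iteratedDeriv_succ]
    exact ((hf.differentiable_iteratedDeriv m (by exact_mod_cast WithTop.coe_lt_top _)) x).hasDerivAt
  induction n generalizing x with
  | zero =>
    rw [iteratedDeriv_succ, iteratedDeriv_zero]
    have h0 := (hasDerivAt_id x).mul (hd 0 x)
    simp only [iteratedDeriv_zero] at h0
    refine h0.deriv.trans ?_
    simp [add_comm]
  | succ n ih =>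
    rw [iteratedDeriv_succ, funext ih]
    refine (((hasDerivAt_id x).mul (hd (n + 1) x)).add
      ((hd n x).const_mul ((n : ℝ) + 1))).deriv.trans ?_
    simp only [id]
    push_cast
    ring

/-- The function `e^{-x} x^n / n!`. -/
def gammaDensity (n : ℕ) (x : ℝ) : ℝ := Real.exp (-x) * x ^ n / n.factorial

lemma contDiff_gammaDensity (n : ℕ) : ContDiff ℝ ∞ (gammaDensity n) := by
  unfold gammaDensity
  fun_prop

lemma hasDerivAt_gammaDensity_succ (n : ℕ) (x : ℝ) :
    HasDerivAt (gammaDensity (n + 1)) (gammaDensity n x - gammaDensity (n + 1) x) x := by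
  have h := (((hasDerivAt_neg x).exp.mul (hasDerivAt_pow (n + 1) x)).div_const
    ((n + 1).factorial : ℝ))
  refine h.congr_deriv ?_
  have : (n.factorial : ℝ) ≠ 0 := by positivity
  simp only [gammaDensity, Nat.factorial_succ]
  push_cast
  field_simp
  ring

/-- The function `e^{-x} L_n(x)`. -/
def laguerreDeriv (n : ℕ) : ℝ → ℝ := iteratedDeriv n (gammaDensity n)

lemma laguerrePoly_eq (n : ℕ) (x : ℝ) : laguerrePoly n x = Real.exp x * laguerreDeriv n x := by
  have : (fun y : ℝ => Real.exp (-y) * y ^ n) = fun y => (n.factorial : ℝ) * gammaDensity n y := by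
    ext y
    have : (n.factorial : ℝ) ≠ 0 := by positivity
    simp only [gammaDensity]
    field_simp
  have h2 : (n.factorial : ℝ) ≠ 0 := by positivity
  rw [laguerrePoly, this, iteratedDeriv_const_mul_field, laguerreDeriv]
  field_simp

lemma contDiff_laguerreDeriv (n : ℕ) : ContDiff ℝ ∞ (laguerreDeriv n) := by
  rw [laguerreDeriv, iteratedDeriv_eq_iterate]
  exact (contDiff_gammaDensity n).iterate_deriv n

lemma contDiff_laguerrePoly (n : ℕ) : ContDiff ℝ ∞ (laguerrePoly n) := by
  have h := contDiff_laguerreDeriv n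
  rw [funext (laguerrePoly_eq n)]
  fun_prop

lemma hasDerivAt_laguerrePoly (n : ℕ) (x : ℝ) :
    HasDerivAt (laguerrePoly n) (deriv (laguerrePoly n) x) x :=
  (((contDiff_laguerrePoly n).differentiable (by simp)) x).hasDerivAt

/-- With γ_n = e^{-x} x^n / n!, differentiate γ_{n+1}' = γ_n - γ_{n+1} another n + 1 times. -/
lemma deriv_laguerreDeriv_succ (n : ℕ) (x : ℝ) :
    deriv (laguerreDeriv (n + 1)) x = deriv (laguerreDeriv n) x - laguerreDeriv (n + 1) x := by
  have h : deriv (gammaDensity (n + 1)) = gammaDensity n - gammaDensity (n + 1) :=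
    funext fun x => (hasDerivAt_gammaDensity_succ n x).deriv
  rw [laguerreDeriv, laguerreDeriv, ← iteratedDeriv_succ, iteratedDeriv_succ', h,
    iteratedDeriv_sub ((contDiff_gammaDensity n).of_le (by exact_mod_cast le_top)).contDiffAt
      ((contDiff_gammaDensity _).of_le (by exact_mod_cast le_top)).contDiffAt, iteratedDeriv_succ]

/-- Differentiate x γ_n = (n+1) γ_{n+1} with Leibniz's rule n + 1 times. -/
lemma laguerreDeriv_succ_sub (n : ℕ) (x : ℝ) :
    x * deriv (laguerreDeriv n) x = (n + 1) * (laguerreDeriv (n + 1) x - laguerreDeriv n x) := by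
  have h : (fun y => y * gammaDensity n y) = fun y => ((n : ℝ) + 1) * gammaDensity (n + 1) y := by
    ext y
    have : (n.factorial : ℝ) ≠ 0 := by positivity
    simp only [gammaDensity, Nat.factorial_succ]
    push_cast
    field_simp
    ring
  have h2 := iteratedDeriv_succ_id_mul (contDiff_gammaDensity n) n x
  rw [h, iteratedDeriv_const_mul_field, iteratedDeriv_succ (f := gammaDensity n)] at h2
  change ((n : ℝ) + 1) * laguerreDeriv (n + 1) x = x * deriv (laguerreDeriv n) x
    + (n + 1) * laguerreDeriv n x at h2
  linarith

lemma deriv_laguerrePoly_eq (n : ℕ) (x : ℝ) :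
    deriv (laguerrePoly n) x =
      Real.exp x * laguerreDeriv n x + Real.exp x * deriv (laguerreDeriv n) x := by
  rw [funext (laguerrePoly_eq n)]
  exact ((Real.hasDerivAt_exp x).mul
    (((contDiff_laguerreDeriv n).differentiable (by simp)) x).hasDerivAt).deriv

lemma deriv_laguerrePoly_succ (n : ℕ) (x : ℝ) :
    deriv (laguerrePoly (n + 1)) x = deriv (laguerrePoly n) x - laguerrePoly n x := by
  rw [deriv_laguerrePoly_eq, deriv_laguerrePoly_eq, deriv_laguerreDeriv_succ, laguerrePoly_eq]
  ring

lemma mul_deriv_laguerrePoly_succ (n : ℕ) (x : ℝ) :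
    x * deriv (laguerrePoly (n + 1)) x = (n + 1) * (laguerrePoly (n + 1) x - laguerrePoly n x) := by
  rw [deriv_laguerrePoly_succ, deriv_laguerrePoly_eq, laguerrePoly_eq, laguerrePoly_eq]
  linear_combination Real.exp x * laguerreDeriv_succ_sub n x

lemma laguerrePoly_zero : laguerrePoly 0 = 1 := by
  ext x
  simp [laguerrePoly, ← Real.exp_add]

lemma deriv_laguerrePoly_zero (x : ℝ) : deriv (laguerrePoly 0) x = 0 := by
  rw [laguerrePoly_zero]
  exact deriv_const x (1 : ℝ)

lemma laguerrePoly_one (x : ℝ) : laguerrePoly 1 x = 1 - x := by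
  have h := mul_deriv_laguerrePoly_succ 0 x
  rw [deriv_laguerrePoly_succ, deriv_laguerrePoly_zero, laguerrePoly_zero] at h
  simp at h
  linarith

/-- The three term recurrence of the Laguerre polynomials. -/
lemma laguerrePoly_rec (n : ℕ) (x : ℝ) :
    (n + 2) * laguerrePoly (n + 2) x =
      (2 * n + 3 - x) * laguerrePoly (n + 1) x - (n + 1) * laguerrePoly n x := by
  have h1 := mul_deriv_laguerrePoly_succ (n + 1) x
  have h2 := mul_deriv_laguerrePoly_succ n x
  rw [deriv_laguerrePoly_succ] at h1
  push_cast at h1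
  linear_combination h2 - h1

lemma deriv_deriv_laguerrePoly_succ (n : ℕ) (x : ℝ) :
    deriv (deriv (laguerrePoly (n + 1))) x =
      deriv (deriv (laguerrePoly n)) x - deriv (laguerrePoly n) x := by
  rw [funext (deriv_laguerrePoly_succ n)]
  have h : ContDiff ℝ 1 (deriv (laguerrePoly n)) := 
    ((contDiff_laguerrePoly n).iterate_deriv 1).of_le (by exact_mod_cast le_top)
  exact ((h.differentiable (by simp) x).hasDerivAt.sub (hasDerivAt_laguerrePoly n x)).deriv

lemma hasDerivAt_deriv_laguerrePoly (n : ℕ) (x : ℝ) :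
    HasDerivAt (deriv (laguerrePoly n)) (deriv (deriv (laguerrePoly n)) x) x := by
  have h : ContDiff ℝ 1 (deriv (laguerrePoly n)) := 
    ((contDiff_laguerrePoly n).iterate_deriv 1).of_le (by exact_mod_cast le_top)
  exact (h.differentiable (by simp) x).hasDerivAt

/-- The differential equation of the Laguerre polynomials. -/
lemma laguerrePoly_ode (n : ℕ) (x : ℝ) :
    x * deriv (deriv (laguerrePoly n)) x + (1 - x) * deriv (laguerrePoly n) x
      + n * laguerrePoly n x = 0 := by
  cases n with
  | zero =>
    rw [funext deriv_laguerrePoly_zero]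
    simp
  | succ n =>
    -- Differentiate x L_{n+1}' = (n+1)(L_{n+1} - L_n), then eliminate L_n and L_n' by the two
    -- first-order relations.
    have h1 := (hasDerivAt_id x).mul (hasDerivAt_deriv_laguerrePoly (n + 1) x)
    have h2 := ((hasDerivAt_laguerrePoly (n + 1) x).sub (hasDerivAt_laguerrePoly n x)).const_mul
      ((n : ℝ) + 1)
    have h3 : id * deriv (laguerrePoly (n + 1)) =
        fun y => ((n : ℝ) + 1) * (laguerrePoly (n + 1) - laguerrePoly n) y :=
      funext fun y => mul_deriv_laguerrePoly_succ n y
    rw [h3] at h1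
    have h4 := h1.unique h2
    have h5 := deriv_laguerrePoly_succ n x
    have h6 := mul_deriv_laguerrePoly_succ n x
    simp only [id] at h4
    push_cast
    linear_combination h4 + ((n : ℝ) + 1) * h5 - h6

/-! ### Bounds for Laguerre polynomials -/

/-- By the differential equation, n L² + x L'² has derivative (2x - 1) L'²; the factor e^{-2x}
absorbs the positive part 2x L'². Comparison with the value n at x = 0 and division by n > 0 give
the bound. It is weaker than the classical e^{x/2}, but only uniformity in n on bounded sets
matters. -/
lemma laguerrePoly_abs_le (n : ℕ) {x : ℝ} (hx : 0 ≤ x) : |laguerrePoly n x| ≤ Real.exp x := by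
  have h0 : ∀ m, laguerrePoly m 0 = 1 := by
    intro m
    induction m with
    | zero => simp [laguerrePoly_zero]
    | succ m ih =>
      have h := mul_deriv_laguerrePoly_succ m 0
      have h2 : (m : ℝ) + 1 ≠ 0 := by positivity
      rw [zero_mul, eq_comm, mul_eq_zero, ih] at h
      rcases h with h | h
      · exact absurd h h2
      · linarith
  rcases Nat.eq_zero_or_pos n with rfl | hn
  · simpa [laguerrePoly_zero] using hx
  -- The energy `(n L² + x L'²) e^{-2x}` decreases.
  set L := laguerrePoly n
  set V : ℝ → ℝ := fun y => (n * L y ^ 2 + y * deriv L y ^ 2) * Real.exp (-2 * y) with hV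
  have hd : ∀ y, HasDerivAt V ((-(2 * n * L y ^ 2) - deriv L y ^ 2) * Real.exp (-2 * y)) y := by
    intro y
    have h1 := hasDerivAt_laguerrePoly n y
    have h2 := hasDerivAt_deriv_laguerrePoly n y
    have h3 := (((h1.pow 2).const_mul (n : ℝ)).add ((hasDerivAt_id y).mul (h2.pow 2))).mul
      (((hasDerivAt_id y).const_mul (-2 : ℝ)).exp)
    refine h3.congr_deriv ?_
    have h4 := laguerrePoly_ode n y
    simp [L] at h4 ⊢
    linear_combination (2 * deriv (laguerrePoly n) y * Real.exp (-(2 * y))) * h4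
  have hanti : AntitoneOn V (Icc 0 x) := by
    refine antitoneOn_of_deriv_nonpos (convex_Icc 0 x)
      (fun y _ => (hd y).continuousAt.continuousWithinAt)
      (fun y _ => (hd y).differentiableAt.differentiableWithinAt) fun y _ => ?_
    rw [(hd y).deriv]
    refine mul_nonpos_of_nonpos_of_nonneg ?_ (Real.exp_pos _).le
    nlinarith [mul_nonneg n.cast_nonneg (sq_nonneg (L y)), sq_nonneg (deriv L y)]
  have h1 := hanti (left_mem_Icc.2 hx) (right_mem_Icc.2 hx) hx
  simp only [hV, L, h0] at h1
  have hn' : (0 : ℝ) < n := by exact_mod_cast hn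
  have h2 : Real.exp (-2 * x) * Real.exp x ^ 2 = 1 := by
    rw [← Real.exp_nat_mul, ← Real.exp_add]
    simp
  have h3 : n * L x ^ 2 * Real.exp (-2 * x) ≤ n := by
    have := mul_nonneg (mul_nonneg hx (sq_nonneg (deriv (laguerrePoly n) x)))
      (Real.exp_pos (-2 * x)).le
    simp at h1 ⊢
    simp only [neg_mul] at this
    nlinarith
  have h4 : L x ^ 2 * Real.exp (-2 * x) ≤ 1 := by
    by_contra hcon
    nlinarith
  refine abs_le_of_sq_le_sq ?_ (Real.exp_pos x).le
  have h5 : 0 < Real.exp x ^ 2 := by positivity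
  calc L x ^ 2 = (L x ^ 2 * Real.exp (-2 * x)) * Real.exp x ^ 2 := by rw [mul_assoc, h2, mul_one]
    _ ≤ 1 * Real.exp x ^ 2 := by gcongr
    _ = _ := one_mul _

/-- Summing L_{k+1}' = L_k' - L_k over k < n costs one power of n; the second derivative costs
another. -/
lemma deriv_laguerrePoly_abs_le (n : ℕ) {x : ℝ} (hx : 0 ≤ x) :
    |deriv (laguerrePoly n) x| ≤ n * Real.exp x := by
  induction n with
  | zero => simp [deriv_laguerrePoly_zero]
  | succ n ih =>
    rw [deriv_laguerrePoly_succ]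
    have := laguerrePoly_abs_le n hx
    refine (abs_sub _ _).trans ?_
    push_cast
    linarith

lemma deriv_deriv_laguerrePoly_abs_le (n : ℕ) {x : ℝ} (hx : 0 ≤ x) :
    |deriv (deriv (laguerrePoly n)) x| ≤ n ^ 2 * Real.exp x := by
  induction n with
  | zero => simp [funext deriv_laguerrePoly_zero]
  | succ n ih =>
    rw [deriv_deriv_laguerrePoly_succ]
    have := deriv_laguerrePoly_abs_le n hx
    refine (abs_sub _ _).trans ?_
    have h2 : 0 ≤ (n + 1) * Real.exp x := by positivity
    push_cast
    nlinarith

/-! ### Laguerre functions on the real line -/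

/-- `L_n(x) e^{-x/2}`. -/
def lag (n : ℕ) (x : ℝ) : ℝ := laguerrePoly n x * Real.exp (-x / 2)

/-- The derivative of `lag`. -/
def lag' (n : ℕ) (x : ℝ) : ℝ :=
  (deriv (laguerrePoly n) x - laguerrePoly n x / 2) * Real.exp (-x / 2)

/-- The second derivative of `lag`. -/
def lag'' (n : ℕ) (x : ℝ) : ℝ :=
  (deriv (deriv (laguerrePoly n)) x - deriv (laguerrePoly n) x + laguerrePoly n x / 4)
    * Real.exp (-x / 2)

lemma hasDerivAt_lag (n : ℕ) (x : ℝ) : HasDerivAt (lag n) (lag' n x) x := by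
  have h := (hasDerivAt_laguerrePoly n x).mul (((hasDerivAt_id x).neg.div_const 2).exp)
  refine h.congr_deriv ?_
  simp [lag']
  ring

lemma hasDerivAt_lag' (n : ℕ) (x : ℝ) : HasDerivAt (lag' n) (lag'' n x) x := by
  have h := ((hasDerivAt_deriv_laguerrePoly n x).sub ((hasDerivAt_laguerrePoly n x).div_const 2)).mul
    (((hasDerivAt_id x).neg.div_const 2).exp)
  refine h.congr_deriv ?_
  simp [lag'']
  ring

/-- The factor e^{-x/2} turns Laguerre's equation into the eigenvalue equation E l_n = n l_n. It
holds at x = 0 too, where the radial operator needs it. -/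
lemma lag_ode (n : ℕ) (x : ℝ) :
    x * lag'' n x + lag' n x - x / 4 * lag n x + 1 / 2 * lag n x = -n * lag n x := by
  simp only [lag, lag', lag'']
  linear_combination Real.exp (-x / 2) * laguerrePoly_ode n x

lemma exp_neg_half_le_one {x : ℝ} (hx : 0 ≤ x) : Real.exp (-x / 2) ≤ 1 := Real.exp_le_one_iff.2 (by linarith)

lemma lag_abs_le (n : ℕ) {x R : ℝ} (hx : 0 ≤ x) (hR : x ≤ R) :
    |lag n x| ≤ Real.exp R := by
  have h1 := laguerrePoly_abs_le n hx
  rw [lag, abs_mul, Real.abs_exp]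
  exact (mul_le_of_le_one_right (abs_nonneg _) (exp_neg_half_le_one hx)).trans
    (h1.trans (Real.exp_le_exp.2 hR))

/-- The power (n+1)² is generous here, so that one summability condition serves both derivatives. -/
lemma lag'_abs_le (n : ℕ) {x R : ℝ} (hx : 0 ≤ x) (hR : x ≤ R) :
    |lag' n x| ≤ Real.exp R * (n + 1) ^ 2 := by
  have h1 := laguerrePoly_abs_le n hx
  have h2 := deriv_laguerrePoly_abs_le n hx
  rw [lag', abs_mul, Real.abs_exp]
  refine (mul_le_of_le_one_right (abs_nonneg _) (exp_neg_half_le_one hx)).trans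
    ((abs_sub _ _).trans ?_)
  rw [abs_div, abs_two]
  have h3 : Real.exp x * (n + 1) ^ 2 ≤ Real.exp R * (n + 1) ^ 2 := by gcongr
  have := Real.exp_pos x
  have h4 : 0 ≤ (n : ℝ) * Real.exp x := by positivity
  have h5 : 0 ≤ (n : ℝ) ^ 2 * Real.exp x := by positivity
  linarith

lemma lag''_abs_le (n : ℕ) {x R : ℝ} (hx : 0 ≤ x) (hR : x ≤ R) :
    |lag'' n x| ≤ Real.exp R * (n + 1) ^ 2 := by
  have h1 := laguerrePoly_abs_le n hx
  have h2 := deriv_laguerrePoly_abs_le n hx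
  have h2' := deriv_deriv_laguerrePoly_abs_le n hx
  rw [lag'', abs_mul, Real.abs_exp]
  refine (mul_le_of_le_one_right (abs_nonneg _) (exp_neg_half_le_one hx)).trans
    ((abs_add_le _ _).trans (add_le_add_left (abs_sub _ _) _) |>.trans ?_)
  rw [abs_div, abs_of_pos (by norm_num : (0 : ℝ) < 4)]
  have h3 : Real.exp x * (n + 1) ^ 2 ≤ Real.exp R * (n + 1) ^ 2 := by gcongr
  have := Real.exp_pos x
  have h4 : 0 ≤ (n : ℝ) * Real.exp x := by positivity
  linarith

/-! ### Hermite polynomials of even degree -/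

lemma contDiff_gaussian : ContDiff ℝ ∞ (fun y : ℝ => Real.exp (-y ^ 2)) := by fun_prop

lemma deriv_gaussian : deriv (fun y : ℝ => Real.exp (-y ^ 2)) =
    fun y => -2 * (y * Real.exp (-y ^ 2)) := by
  ext y
  refine ((hasDerivAt_pow 2 y).neg.exp).deriv.trans ?_
  simp
  ring

lemma hermitePoly_zero (y : ℝ) : hermitePoly 0 y = 1 := by
  simp [hermitePoly, ← Real.exp_add]

lemma hermitePoly_one (y : ℝ) : hermitePoly 1 y = 2 * y := by
  have h : Real.exp (y ^ 2) * Real.exp (-y ^ 2) = 1 := by rw [← Real.exp_add]; simp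
  rw [hermitePoly, iteratedDeriv_one, deriv_gaussian]
  linear_combination 2 * y * h

lemma hermitePoly_rec (n : ℕ) (y : ℝ) :
    hermitePoly (n + 2) y = 2 * y * hermitePoly (n + 1) y - 2 * (n + 1) * hermitePoly n y := by
  simp only [hermitePoly]
  rw [iteratedDeriv_succ' (n := n + 1), deriv_gaussian, iteratedDeriv_const_mul_field,
    iteratedDeriv_succ_id_mul contDiff_gaussian]
  ring

lemma hermitePoly_neg (n : ℕ) (y : ℝ) : hermitePoly n (-y) = (-1) ^ n * hermitePoly n y := by
  have h := iteratedDeriv_comp_neg n (fun y : ℝ => Real.exp (-y ^ 2)) y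
  simp only [neg_sq, smul_eq_mul] at h
  have h2 : ((-1 : ℝ) ^ n) * (-1) ^ n = 1 := by rw [← mul_pow]; simp
  simp only [hermitePoly, neg_sq]
  rw [h]
  linear_combination (-(-1) ^ n * Real.exp (y ^ 2) *
    iteratedDeriv n (fun y : ℝ => Real.exp (-y ^ 2)) (-y)) * h2

/-- `(-1)^m H_{2m}(y) / (4^m m!)`. -/
def evenHermitePoly (m : ℕ) (y : ℝ) : ℝ :=
  (-1) ^ m * hermitePoly (2 * m) y / (4 ^ m * m.factorial)

/-- The sequences whose generating function `F` solves `(1-t)² F' = (γ (1-t) - x) F`. -/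
def IsLaguerreSeq (γ x : ℝ) (q : ℕ → ℝ) : Prop :=
  q 1 = (γ - x) * q 0 ∧
    ∀ n : ℕ, (n + 2) * q (n + 2) = (2 * n + 2 + γ - x) * q (n + 1) - (n + γ) * q n

lemma isLaguerreSeq_laguerrePoly (x : ℝ) : IsLaguerreSeq 1 x (fun n => laguerrePoly n x) := by
  refine ⟨?_, fun n => ?_⟩
  · simp [laguerrePoly_one, laguerrePoly_zero]
  · linear_combination laguerrePoly_rec n x

/-- In this normalization the even Hermite polynomials are the generalized Laguerre polynomials with
parameter -1/2 at y², hence γ = 1/2. -/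
lemma isLaguerreSeq_evenHermitePoly (y : ℝ) :
    IsLaguerreSeq (1 / 2) (y ^ 2) (fun m => evenHermitePoly m y) := by
  refine ⟨?_, fun m => ?_⟩
  · simp [evenHermitePoly, hermitePoly_rec 0, hermitePoly_one, hermitePoly_zero]
    ring
  · have h1 := hermitePoly_rec (2 * m + 2) y
    have h2 := hermitePoly_rec (2 * m + 1) y
    have h3 := hermitePoly_rec (2 * m) y
    have hm : (m.factorial : ℝ) ≠ 0 := by positivity
    simp only [evenHermitePoly, Nat.factorial_succ, show 2 * (m + 2) = 2 * m + 2 + 2 by ring,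
      show 2 * (m + 1) = 2 * m + 2 by ring]
    push_cast at h1 h2 h3 ⊢
    have h4 : (m : ℝ) + 1 ≠ 0 := by positivity
    have h5 : (m : ℝ) + 2 ≠ 0 := by positivity
    have h6 : (m : ℝ) + 1 + 1 ≠ 0 := by positivity
    have e1 : (-1 : ℝ) ^ (m + 2) = (-1) ^ m := by ring
    have e2 : (-1 : ℝ) ^ (m + 1) = -(-1) ^ m := by ring
    rw [e1, e2]
    field_simp
    -- Three consecutive Hermite recurrences, with the two odd-degree polynomials eliminated.
    have key : hermitePoly (2 * m + 2 + 2) y =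
        (4 * y ^ 2 - 8 * m - 10) * hermitePoly (2 * m + 2) y
          - 8 * (m + 1) * (2 * m + 1) * hermitePoly (2 * m) y := by
      have h2' : hermitePoly (2 * m + 2 + 1) y = hermitePoly (2 * m + 1 + 2) y := rfl
      rw [h2'] at h1
      have h2'' : hermitePoly (2 * m + 1 + 1) y = hermitePoly (2 * m + 2) y := rfl
      rw [h2''] at h2
      linear_combination h1 + 2 * y * h2 + 4 * (m + 1) * h3
    rw [key]
    ring

/-! ### Generating functions and the passage between γ = 1/2 and γ = 1 -/

open PowerSeries in
lemma constantCoeff_derivative_mk (q : ℕ → ℝ) :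
    constantCoeff (derivative ℝ (mk q)) = q 1 := by
  rw [← coeff_zero_eq_constantCoeff_apply, coeff_derivative]
  simp

-- The coefficient of t^0 is the initial condition and that of t^{n+1} is the recurrence. Powers of
-- X are split off as shifts first; the double shift makes t^1 a separate case.
open PowerSeries in
lemma isLaguerreSeq_iff (γ x : ℝ) (q : ℕ → ℝ) :
    IsLaguerreSeq γ x q ↔
      (1 - X) ^ 2 * derivative ℝ (mk q) = (C γ * (1 - X) - C x) * mk q := by
  have e1 : (1 - X) ^ 2 * derivative ℝ (mk q) = derivative ℝ (mk q) - X * derivative ℝ (mk q)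
      - X * derivative ℝ (mk q) + X * (X * derivative ℝ (mk q)) := by ring
  have e2 : (C γ * (1 - X) - C x) * mk q = C γ * mk q - X * (C γ * mk q) - C x * mk q := by ring
  rw [e1, e2, PowerSeries.ext_iff]
  constructor
  · rintro ⟨h0, h1⟩ (_ | _ | n)
    · simp [constantCoeff_derivative_mk]
      linarith
    · have := h1 0
      simp [coeff_succ_X_mul, coeff_derivative] at this ⊢
      linarith
    · have := h1 (n + 1)
      simp [coeff_succ_X_mul, coeff_derivative] at this ⊢
      linear_combination this
  · intro h
    refine ⟨?_, ?_⟩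
    · have := h 0
      simp [constantCoeff_derivative_mk] at this
      linarith
    · rintro (_ | n)
      · have := h 1
        simp [coeff_succ_X_mul, coeff_derivative] at this ⊢
        linarith
      · have := h (n + 2)
        simp [coeff_succ_X_mul, coeff_derivative] at this ⊢
        linear_combination this

lemma IsLaguerreSeq.ext {γ x : ℝ} {q q' : ℕ → ℝ} (h : IsLaguerreSeq γ x q)
    (h' : IsLaguerreSeq γ x q') (h0 : q 0 = q' 0) (n : ℕ) : q n = q' n := by
  induction n using Nat.strong_induction_on with
  | _ n ih =>
    match n with
    | 0 => exact h0
    | 1 => rw [h.1, h'.1, h0]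
    | n + 2 =>
      have h1 := h.2 n
      have h2 := h'.2 n
      rw [ih (n + 1) (by omega), ih n (by omega), ← h2] at h1
      exact mul_left_cancel₀ (by positivity) h1

/-- The Taylor coefficients of `(1 - t)^{-β}`. -/
def binomialCoeff (β : ℝ) : ℕ → ℝ
  | 0 => 1
  | n + 1 => (n + β) / (n + 1) * binomialCoeff β n

/-- Each factor satisfies |n + β| ≤ n + 1. Boundedness is enough, since the expansion coefficients
beat every power of n. -/
lemma binomialCoeff_abs_le {β : ℝ} (hβ : |β| ≤ 1) (n : ℕ) : |binomialCoeff β n| ≤ 1 := by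
  induction n with
  | zero => simp [binomialCoeff]
  | succ n ih =>
    rw [binomialCoeff, abs_mul]
    refine mul_le_one₀ ?_ (abs_nonneg _) ih
    have : (0 : ℝ) < n + 1 := by positivity
    rw [abs_div, abs_of_pos this, div_le_one this]
    exact (abs_add_le _ _).trans (by simpa using hβ)

open PowerSeries in
lemma derivative_binomialCoeff (β : ℝ) :
    (1 - X) * derivative ℝ (mk (binomialCoeff β)) = C β * mk (binomialCoeff β) := by
  have h : ∀ n : ℕ, binomialCoeff β (n + 1) * (n + 1) = (n + β) * binomialCoeff β n := by
    intro n
    have : (n : ℝ) + 1 ≠ 0 := by positivity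
    rw [binomialCoeff]
    field_simp
  rw [sub_mul, one_mul]
  ext n
  cases n with
  | zero =>
    have := h 0
    simp [constantCoeff_derivative_mk] at this ⊢
    linarith
  | succ n =>
    have := h (n + 1)
    simp [coeff_succ_X_mul, coeff_derivative] at this ⊢
    linear_combination this

/-- The convolution of the Taylor coefficients of `(1 - t)^{-β}` with a sequence. -/
def binomialConv {R : Type*} [AddCommMonoid R] [Module ℝ R] (β : ℝ) (q : ℕ → R) (m : ℕ) : R :=
  ∑ p ∈ Finset.HasAntidiagonal.antidiagonal m, binomialCoeff β p.1 • q p.2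

-- Multiplying the generating function by (1-t)^{-β} adds β/(1-t) to its logarithmic derivative,
-- which moves γ to γ + β and leaves x alone.
open PowerSeries in
lemma IsLaguerreSeq.binomialConv {γ x : ℝ} {q : ℕ → ℝ} (h : IsLaguerreSeq γ x q) (β : ℝ) :
    IsLaguerreSeq (γ + β) x (binomialConv β q) := by
  have e : mk (LaguerreCauchy.binomialConv β q) = mk (binomialCoeff β) * mk q := by
    ext n
    simp [coeff_mul, LaguerreCauchy.binomialConv]
  rw [isLaguerreSeq_iff] at h ⊢
  have h2 := derivative_binomialCoeff β
  rw [e, Derivation.leibniz, map_add]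
  simp only [smul_eq_mul]
  linear_combination (mk (binomialCoeff β)) * h + (1 - X) * mk q * h2

lemma binomialConv_zero {R : Type*} [AddCommMonoid R] [Module ℝ R] (β : ℝ) (q : ℕ → R) :
    binomialConv β q 0 = q 0 := by
  simp [binomialConv, binomialCoeff]

/-- Both sides obey the recurrence with γ = 1/2 + 1/2 = 1 and start at 1. The converse relation uses
β = -1/2 in the same way. -/
lemma laguerrePoly_sq_eq (m : ℕ) (y : ℝ) :
    laguerrePoly m (y ^ 2) = binomialConv (1 / 2) (fun k => evenHermitePoly k y) m := by
  have h := (isLaguerreSeq_evenHermitePoly y).binomialConv (1 / 2)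
  norm_num at h
  norm_num
  refine (isLaguerreSeq_laguerrePoly (y ^ 2)).ext h ?_ m
  simp [binomialConv_zero, laguerrePoly_zero, evenHermitePoly, hermitePoly_zero]

lemma evenHermitePoly_eq (m : ℕ) (y : ℝ) :
    evenHermitePoly m y = binomialConv (-1 / 2) (fun k => laguerrePoly k (y ^ 2)) m := by
  have h := (isLaguerreSeq_laguerrePoly (y ^ 2)).binomialConv (-1 / 2)
  norm_num at h
  have h' := isLaguerreSeq_evenHermitePoly y
  norm_num at h' ⊢
  refine h'.ext h ?_ m
  simp [binomialConv_zero, laguerrePoly_zero, evenHermitePoly, hermitePoly_zero]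

/-- The even Hermite function in the normalization of `evenHermitePoly`. -/
def evenHerm (m : ℕ) (y : ℝ) : ℝ := evenHermitePoly m y * Real.exp (-y ^ 2 / 2)

lemma lag_sq_eq (m : ℕ) (y : ℝ) :
    lag m (y ^ 2) = binomialConv (1 / 2) (fun k => evenHerm k y) m := by
  rw [lag, laguerrePoly_sq_eq, binomialConv, binomialConv, Finset.sum_mul]
  simp [evenHerm, mul_assoc]

lemma evenHerm_eq (m : ℕ) (y : ℝ) :
    evenHerm m y = binomialConv (-1 / 2) (fun k => lag k (y ^ 2)) m := by
  rw [evenHerm, evenHermitePoly_eq, binomialConv, binomialConv, Finset.sum_mul]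
  simp [lag, mul_assoc]

lemma evenHerm_abs_le (m : ℕ) (y : ℝ) : |evenHerm m y| ≤ Real.exp (y ^ 2) * (m + 1) := by
  rw [evenHerm_eq, binomialConv]
  refine (Finset.abs_sum_le_sum_abs _ _).trans ?_
  refine (Finset.sum_le_card_nsmul _ _ (Real.exp (y ^ 2)) fun p _ => ?_).trans ?_
  · rw [smul_eq_mul, abs_mul]
    calc _ ≤ 1 * Real.exp (y ^ 2) := by
          gcongr
          · exact binomialCoeff_abs_le (by norm_num [abs_le]) _
          · exact lag_abs_le _ (sq_nonneg y) le_rfl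
      _ = _ := one_mul _
  · simp [mul_comm]

/-- The factor between `h_{2m}` and `evenHerm m`. -/
def hermiteNorm (m : ℕ) : ℝ :=
  (-1) ^ m * (4 ^ m * m.factorial) *
    (Real.sqrt (2 ^ (2 * m) * ((2 * m).factorial : ℝ) * Real.sqrt Real.pi))⁻¹

lemma hermiteFun_even (m : ℕ) (y : ℝ) :
    hermiteFun (2 * m) y = ((hermiteNorm m * evenHerm m y : ℝ) : ℂ) := by
  rw [hermiteFun, hermiteNorm, evenHerm, evenHermitePoly]
  congr 1
  have h1 : (m.factorial : ℝ) ≠ 0 := by positivity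
  have h2 : ((-1 : ℝ) ^ m) * (-1) ^ m = 1 := by rw [← mul_pow]; simp
  field_simp
  linear_combination (-hermitePoly (2 * m) y) * h2

lemma hermiteFun_neg (n : ℕ) (y : ℝ) : hermiteFun n (-y) = (-1) ^ n * hermiteFun n y := by
  simp only [hermiteFun, hermitePoly_neg, neg_sq]
  push_cast
  ring

/-- Since (2m)! is the central binomial coefficient times m!², the size is governed by 4^m over that
coefficient, which lies between 1 and 2m for m ≥ 1. Hence the norming factor and its inverse are
polynomially bounded. -/
lemma hermiteNorm_sq (m : ℕ) :
    hermiteNorm m ^ 2 = 4 ^ m / (Nat.centralBinom m * Real.sqrt Real.pi) := by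
  have h1 : (m.factorial : ℝ) ≠ 0 := by positivity
  have h2 : ((-1 : ℝ) ^ m) ^ 2 = 1 := by rw [← pow_mul, mul_comm, pow_mul]; simp
  have h3 : (Nat.centralBinom m : ℝ) * (m.factorial * m.factorial) = (2 * m).factorial := by
    have := Nat.choose_mul_factorial_mul_factorial (n := 2 * m) (k := m) (by omega)
    rw [show 2 * m - m = m by omega] at this
    rw [Nat.centralBinom, ← this]
    push_cast
    ring
  have h4 : 0 < (Nat.centralBinom m : ℝ) := by exact_mod_cast Nat.centralBinom_pos m
  have h5 : 0 < Real.sqrt Real.pi := Real.sqrt_pos.2 Real.pi_pos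
  rw [hermiteNorm, mul_pow, mul_pow, h2, inv_pow, Real.sq_sqrt (by positivity), ← h3, pow_mul]
  norm_num
  field_simp

lemma hermiteNorm_ne_zero (m : ℕ) : hermiteNorm m ≠ 0 := by
  have h4 : 0 < (Nat.centralBinom m : ℝ) := by exact_mod_cast Nat.centralBinom_pos m
  have h5 : 0 < Real.sqrt Real.pi := Real.sqrt_pos.2 Real.pi_pos
  have : 0 < hermiteNorm m ^ 2 := by rw [hermiteNorm_sq]; positivity
  exact fun h => by simp [h] at this

lemma one_le_sqrt_pi : 1 ≤ Real.sqrt Real.pi :=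
  Real.one_le_sqrt.2 (by linarith [Real.pi_gt_three])

lemma hermiteNorm_abs_le (m : ℕ) : |hermiteNorm m| ≤ 2 * (m + 1) := by
  have h4 : 0 < (Nat.centralBinom m : ℝ) := by exact_mod_cast Nat.centralBinom_pos m
  refine abs_le_of_sq_le_sq ?_ (by positivity)
  rw [hermiteNorm_sq, div_le_iff₀ (by have := one_le_sqrt_pi; positivity)]
  have h : (4 : ℝ) ^ m ≤ 2 * (m + 1) * Nat.centralBinom m := by
    rcases Nat.eq_zero_or_pos m with rfl | hm
    · simp
    · have : (4 : ℝ) ^ m ≤ 2 * m * Nat.centralBinom m := by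
        exact_mod_cast Nat.four_pow_le_two_mul_self_mul_centralBinom m hm
      linarith
  refine h.trans ?_
  rw [← mul_assoc]
  refine (le_mul_of_one_le_right (by positivity) one_le_sqrt_pi).trans' ?_
  gcongr
  have : (0 : ℝ) ≤ m := by positivity
  nlinarith

lemma hermiteNorm_inv_abs_le (m : ℕ) : |(hermiteNorm m)⁻¹| ≤ 2 := by
  refine abs_le_of_sq_le_sq ?_ (by positivity)
  have h1 : (Nat.centralBinom m : ℝ) ≤ 4 ^ m := by
    have := Nat.choose_le_two_pow (2 * m) m
    rw [pow_mul] at this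
    exact_mod_cast this
  have h2 : Real.sqrt Real.pi ≤ 2 := Real.sqrt_le_iff.2 ⟨by norm_num, by linarith [Real.pi_le_four]⟩
  rw [inv_pow, hermiteNorm_sq, inv_div, div_le_iff₀ (by positivity)]
  nlinarith [mul_le_mul h1 h2 (Real.sqrt_nonneg _) (by positivity), pow_pos (four_pos (α := ℝ)) m]

/-! ### Operators on the weighted sequence spaces -/

/-- In the variable z = n^{1/(2s)} this compares z^{2sj} with e^{rz}. -/
lemma exists_pow_le_weight {r s : ℝ} (hr : 0 < r) (hs : 0 < s) (j : ℕ) :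
    ∃ C : ℝ, 0 < C ∧ ∀ n : ℕ, ((n : ℝ) + 1) ^ j ≤ C * weight r s n := by
  have hp : 0 < 1 / (2 * s) := by positivity
  have h1 : (fun n : ℕ => ((n : ℝ) ^ (1 / (2 * s))) ^ ((2 * s) * j)) =o[atTop]
      fun n : ℕ => weight r s n :=
    (isLittleO_rpow_exp_pos_mul_atTop ((2 * s) * j) hr).comp_tendsto
      ((tendsto_rpow_atTop hp).comp tendsto_natCast_atTop_atTop)
  have h2 : (fun n : ℕ => ((n : ℝ) + 1) ^ j) =O[atTop]
      fun n : ℕ => ((n : ℝ) ^ (1 / (2 * s))) ^ ((2 * s) * j) := by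
    refine Asymptotics.IsBigO.of_bound (2 ^ j) ?_
    filter_upwards [eventually_ge_atTop 1] with n hn
    have hn' : (1 : ℝ) ≤ n := by exact_mod_cast hn
    rw [← Real.rpow_mul (by positivity), ← mul_assoc, one_div_mul_cancel (by positivity), one_mul,
      Real.rpow_natCast, Real.norm_of_nonneg (by positivity), Real.norm_of_nonneg (by positivity),
      ← mul_pow]
    gcongr
    linarith
  obtain ⟨C, hC, h⟩ := Asymptotics.bound_of_isBigO_nat_atTop (h2.trans h1.isBigO)
  refine ⟨C, hC, fun n => ?_⟩
  have := h (x := n) (weight_pos r s n).ne'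
  rwa [Real.norm_of_nonneg (by positivity), Real.norm_of_nonneg (weight_pos r s n).le] at this

lemma weight_half_mul (r s : ℝ) (n : ℕ) : weight (r / 2) s n * weight (r / 2) s n = weight r s n := by
  rw [weight, weight, ← Real.exp_add]
  ring_nf

lemma weight_le_weight {r s : ℝ} (hr : 0 ≤ r) (hs : 0 < s) {m n : ℕ} (h : m ≤ n) :
    weight r s m ≤ weight r s n := by
  unfold weight
  gcongr

lemma WeightedBound.nonneg {r s M : ℝ} {a : ℕ → ℂ} (h : WeightedBound r s M a) : 0 ≤ M :=
  (mul_nonneg (norm_nonneg _) (weight_pos r s 0).le).trans (h 0)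

/-- Half of the exponential weight pays for the power of n; the other half remains. -/
lemma exists_weightedBound_pow {r s : ℝ} (hr : 0 < r) (hs : 0 < s) (j : ℕ) :
    ∃ C : ℝ, 0 < C ∧ ∀ (M : ℝ) (a : ℕ → ℂ), WeightedBound r s M a →
      ∀ n : ℕ, ‖a n‖ * ((n : ℝ) + 1) ^ j * weight (r / 2) s n ≤ C * M := by
  obtain ⟨C, hC, h⟩ := exists_pow_le_weight (half_pos hr) hs j
  refine ⟨C, hC, fun M a ha n => ?_⟩
  calc ‖a n‖ * ((n : ℝ) + 1) ^ j * weight (r / 2) s n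
      ≤ ‖a n‖ * (C * weight (r / 2) s n) * weight (r / 2) s n := by
        have := (weight_pos (r / 2) s n).le
        gcongr
        exact h n
    _ = C * (‖a n‖ * weight r s n) := by rw [← weight_half_mul r s n]; ring
    _ ≤ C * M := by
        gcongr
        exact ha n

lemma MemEll.exists_weightedBound {k : Kind} {s : ℝ} {a : ℕ → ℂ} (h : MemEll k s a) :
    ∃ r : ℝ, 0 < r ∧ ∃ M : ℝ, WeightedBound r s M a := by
  cases k with
  | roumieu => exact h
  | beurling => exact ⟨1, one_pos, h 1 one_pos⟩

lemma MemEll.exists_pow_bound {k : Kind} {s : ℝ} (hs : 0 < s) {a : ℕ → ℂ} (h : MemEll k s a)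
    (j : ℕ) : ∃ D : ℝ, ∀ n : ℕ, ‖a n‖ * ((n : ℝ) + 1) ^ j ≤ D := by
  obtain ⟨r, hr, M, hM⟩ := h.exists_weightedBound
  obtain ⟨C, -, hC⟩ := exists_weightedBound_pow hr hs j
  refine ⟨C * M, fun n => (le_mul_of_one_le_right (by positivity) ?_).trans (hC M a hM n)⟩
  rw [weight]
  exact Real.one_le_exp (by positivity)

lemma summable_inv_succ_sq : Summable fun n : ℕ => (((n : ℝ) + 1) ^ 2)⁻¹ := by
  have := (summable_nat_add_iff 1).2 (Real.summable_nat_pow_inv.2 (one_lt_two))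
  simpa using this

lemma MemEll.summable {k : Kind} {s : ℝ} (hs : 0 < s) {a : ℕ → ℂ} (h : MemEll k s a) (j : ℕ) :
    Summable fun n : ℕ => ‖a n‖ * ((n : ℝ) + 1) ^ j := by
  obtain ⟨D, hD⟩ := h.exists_pow_bound hs (j + 2)
  refine Summable.of_nonneg_of_le (fun n => by positivity) (fun n => ?_)
    (summable_inv_succ_sq.mul_left D)
  rw [← div_eq_mul_inv, le_div_iff₀ (by positivity), mul_assoc, ← pow_add]
  exact hD n

/-- The transformation `T` of sequences maps each weighted space into the one whose index is
smaller by a constant factor, with a bound for the norms. -/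
def IsTransfer (s : ℝ) (T : (ℕ → ℂ) → ℕ → ℂ) : Prop :=
  ∃ θ : ℝ, 0 < θ ∧ ∀ r : ℝ, 0 < r → ∃ C : ℝ, ∀ (M : ℝ) (a : ℕ → ℂ),
    WeightedBound r s M a → WeightedBound (θ * r) s (C * M) (T a)

/-- The factor θ does not depend on r, so in the Beurling case a prescribed index r is reached by
starting from r/θ. -/
lemma IsTransfer.memEll {s : ℝ} {T : (ℕ → ℂ) → ℕ → ℂ} (hT : IsTransfer s T) {k : Kind}
    {a : ℕ → ℂ} (ha : MemEll k s a) : MemEll k s (T a) := by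
  obtain ⟨θ, hθ, h⟩ := hT
  cases k with
  | roumieu =>
    obtain ⟨r, hr, M, hM⟩ := ha
    obtain ⟨C, hC⟩ := h r hr
    exact ⟨θ * r, mul_pos hθ hr, C * M, hC M a hM⟩
  | beurling =>
    intro r hr
    obtain ⟨C, hC⟩ := h (r / θ) (div_pos hr hθ)
    obtain ⟨M, hM⟩ := ha (r / θ) (div_pos hr hθ)
    have := hC M a hM
    rw [mul_div_cancel₀ r hθ.ne'] at this
    exact ⟨C * M, this⟩

lemma IsTransfer.comp {s : ℝ} {T U : (ℕ → ℂ) → ℕ → ℂ} (hT : IsTransfer s T)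
    (hU : IsTransfer s U) : IsTransfer s (T ∘ U) := by
  obtain ⟨θ, hθ, h⟩ := hT
  obtain ⟨θ', hθ', h'⟩ := hU
  refine ⟨θ * θ', mul_pos hθ hθ', fun r hr => ?_⟩
  obtain ⟨C', hC'⟩ := h' r hr
  obtain ⟨C, hC⟩ := h (θ' * r) (mul_pos hθ' hr)
  refine ⟨C * C', fun M a ha => ?_⟩
  rw [mul_assoc, mul_assoc]
  exact hC _ _ (hC' _ _ ha)

lemma isTransfer_diagonal {s : ℝ} (hs : 0 < s) {d : ℕ → ℂ} {K : ℝ} {j : ℕ}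
    (hd : ∀ n : ℕ, ‖d n‖ ≤ K * ((n : ℝ) + 1) ^ j) : IsTransfer s (fun a n => d n * a n) := by
  refine ⟨1 / 2, by norm_num, fun r hr => ?_⟩
  obtain ⟨C, -, hC⟩ := exists_weightedBound_pow hr hs j
  have hK : 0 ≤ K := by
    have := (norm_nonneg _).trans (hd 0)
    simpa using this
  refine ⟨K * C, fun M a ha n => ?_⟩
  rw [norm_mul, show 1 / 2 * r = r / 2 by ring]
  have := (weight_pos (r / 2) s n).le
  calc ‖d n‖ * ‖a n‖ * weight (r / 2) s n
      ≤ K * ((n : ℝ) + 1) ^ j * ‖a n‖ * weight (r / 2) s n := by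
        gcongr
        exact hd n
    _ = K * (‖a n‖ * ((n : ℝ) + 1) ^ j * weight (r / 2) s n) := by ring
    _ ≤ K * (C * M) := mul_le_mul_of_nonneg_left (hC M a ha n) hK
    _ = _ := by ring

lemma isTransfer_even {s : ℝ} (hs : 0 < s) : IsTransfer s (fun a n => a (2 * n)) := by
  refine ⟨1, one_pos, fun r hr => ⟨1, fun M a ha n => ?_⟩⟩
  rw [one_mul, one_mul]
  refine (mul_le_mul_of_nonneg_left ?_ (norm_nonneg _)).trans (ha (2 * n))
  exact weight_le_weight hr.le hs (by omega)

/-- The sequence whose even terms are those of `a` and whose odd terms vanish. -/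
def spread (a : ℕ → ℂ) (n : ℕ) : ℂ := if Even n then a (n / 2) else 0

lemma spread_two_mul (a : ℕ → ℂ) (n : ℕ) : spread a (2 * n) = a n := by
  simp [spread]

lemma spread_of_odd (a : ℕ → ℂ) {n : ℕ} (hn : ¬ Even n) : spread a n = 0 := by
  simp [spread, hn]

lemma isTransfer_spread (s : ℝ) : IsTransfer s spread := by
  -- Doubling the position multiplies n^{1/(2s)} by 2^{1/(2s)}; θ compensates exactly.
  refine ⟨(2 ^ (1 / (2 * s)))⁻¹, by positivity, fun r _ => ⟨1, fun M a ha n => ?_⟩⟩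
  rw [one_mul]
  by_cases hn : Even n
  · obtain ⟨m, rfl⟩ := hn.exists_two_nsmul
    rw [smul_eq_mul, spread_two_mul]
    convert ha m using 2
    rw [weight, weight]
    congr 1
    push_cast
    rw [Real.mul_rpow (by norm_num) (by positivity)]
    have : (2 : ℝ) ^ (1 / (2 * s)) ≠ 0 := by positivity
    field_simp
  · rw [spread_of_odd a hn, norm_zero, zero_mul]
    exact ha.nonneg

/-- The transpose of `binomialConv`. -/
def binomialTail (β : ℝ) (a : ℕ → ℂ) (k : ℕ) : ℂ := ∑' j, (binomialCoeff β j : ℂ) * a (j + k)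

/-- Two powers of j + k + 1, paid for by half of the weight, make the sum over j converge; the
remaining weight at j + k dominates the one at k. -/
lemma isTransfer_binomialTail {s β : ℝ} (hs : 0 < s) (hβ : |β| ≤ 1) :
    IsTransfer s (binomialTail β) := by
  refine ⟨1 / 2, by norm_num, fun r hr => ?_⟩
  obtain ⟨C, hC, h⟩ := exists_weightedBound_pow hr hs 2
  obtain ⟨S, hS⟩ := summable_inv_succ_sq
  refine ⟨S * C, fun M a ha k => ?_⟩
  have hw := weight_pos (r / 2) s k
  rw [show 1 / 2 * r = r / 2 by ring, ← le_div_iff₀ hw]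
  have hM := ha.nonneg
  rw [mul_assoc, mul_div_assoc]
  refine tsum_of_norm_bounded (hS.mul_right _) fun j => ?_
  rw [norm_mul, Complex.norm_real]
  refine (mul_le_of_le_one_left (norm_nonneg _) (binomialCoeff_abs_le hβ j)).trans ?_
  rw [← div_eq_inv_mul, div_div, le_div_iff₀ (by positivity)]
  refine le_trans ?_ (h M a ha (j + k))
  have h1 := weight_le_weight (half_pos hr).le hs (Nat.le_add_left k j)
  calc ‖a (j + k)‖ * (weight (r / 2) s k * ((j : ℝ) + 1) ^ 2)
      ≤ ‖a (j + k)‖ * (weight (r / 2) s (j + k) * (((j + k : ℕ) : ℝ) + 1) ^ 2) := by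
        have := weight_pos (r / 2) s (j + k)
        gcongr
        exact Nat.le_add_right j k
    _ = _ := by ring

lemma ofReal_binomialConv (β : ℝ) (q : ℕ → ℝ) (m : ℕ) :
    ((binomialConv β q m : ℝ) : ℂ) = binomialConv β (fun k => (q k : ℂ)) m := by
  simp [binomialConv]

/-- Fubini for the double series ∑ c_j a_{j+k} f_k. The exponent 5 provides two powers for the sum
over j, two for the sum over k, and one for the growth of f. -/
lemma hasSum_binomialTail {β F D : ℝ} (hβ : |β| ≤ 1) {a f : ℕ → ℂ} {S : ℂ}
    (ha : ∀ n : ℕ, ‖a n‖ * ((n : ℝ) + 1) ^ 5 ≤ D) (hf : ∀ k : ℕ, ‖f k‖ ≤ F * ((k : ℝ) + 1))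
    (h : HasSum (fun m => a m * binomialConv β f m) S) :
    HasSum (fun k => binomialTail β a k * f k) S := by
  have hD : 0 ≤ D := (by positivity : (0 : ℝ) ≤ ‖a 0‖ * (((0 : ℕ) : ℝ) + 1) ^ 5).trans (ha 0)
  have hF : 0 ≤ F := by simpa using (norm_nonneg _).trans (hf 0)
  set G : ℕ × ℕ → ℂ := fun p => (binomialCoeff β p.1 : ℂ) * a (p.1 + p.2) * f p.2 with hG
  have hsum : Summable G := by
    refine Summable.of_norm_bounded (g := fun p : ℕ × ℕ =>
      D * F * ((((p.1 : ℝ) + 1) ^ 2)⁻¹ * (((p.2 : ℝ) + 1) ^ 2)⁻¹))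
      ((summable_inv_succ_sq.mul_of_nonneg summable_inv_succ_sq (fun n => by positivity)
        fun n => by positivity).mul_left _) fun ⟨j, k⟩ => ?_
    simp only [hG, norm_mul, Complex.norm_real]
    rw [← mul_inv, ← div_eq_mul_inv, le_div_iff₀ (by positivity)]
    have e1 : ((j : ℝ) + 1) ^ 2 ≤ (((j + k : ℕ) : ℝ) + 1) ^ 2 := by
      gcongr
      exact Nat.le_add_right j k
    have e2 : ((k : ℝ) + 1) ^ 3 ≤ (((j + k : ℕ) : ℝ) + 1) ^ 3 := by
      gcongr
      exact Nat.le_add_left k j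
    calc ‖binomialCoeff β j‖ * ‖a (j + k)‖ * ‖f k‖ * (((j : ℝ) + 1) ^ 2 * ((k : ℝ) + 1) ^ 2)
        ≤ 1 * ‖a (j + k)‖ * (F * ((k : ℝ) + 1)) * (((j : ℝ) + 1) ^ 2 * ((k : ℝ) + 1) ^ 2) := by
          gcongr
          · exact binomialCoeff_abs_le hβ j
          · exact hf k
      _ = (‖a (j + k)‖ * (((j : ℝ) + 1) ^ 2 * ((k : ℝ) + 1) ^ 3)) * F := by ring
      _ ≤ (‖a (j + k)‖ * ((((j + k : ℕ) : ℝ) + 1) ^ 2 * (((j + k : ℕ) : ℝ) + 1) ^ 3)) * F := by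
          gcongr
      _ = (‖a (j + k)‖ * (((j + k : ℕ) : ℝ) + 1) ^ 5) * F := by ring
      _ ≤ D * F := by
          gcongr
          exact ha (j + k)
  obtain ⟨S', hS'⟩ := hsum
  -- Summation along antidiagonals recovers the given series, which identifies the sum of the double
  -- series; summation over j for fixed k then gives the claim.
  have h1 : HasSum (fun m => a m * binomialConv β f m) S' := by
    have := ((Finset.HasAntidiagonal.sigmaAntidiagonalEquivProd (A := ℕ)).hasSum_iff.2 hS').sigma
      fun m => hasSum_fintype _
    convert this using 2 with m
    rw [binomialConv, Finset.mul_sum, ← Finset.sum_coe_sort]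
    refine Finset.sum_congr rfl fun p _ => ?_
    have hp : (p : ℕ × ℕ).1 + (p : ℕ × ℕ).2 = m := Finset.HasAntidiagonal.mem_antidiagonal.1 p.2
    simp only [hG, Function.comp, Finset.HasAntidiagonal.sigmaAntidiagonalEquivProd_apply, hp,
      Complex.real_smul]
    ring
  have h2 : HasSum (fun k => binomialTail β a k * f k) S' := by
    have h3 := (Equiv.prodComm ℕ ℕ).hasSum_iff.2 hS'
    refine h3.prod_fiberwise fun k => ?_
    have h4 := ((h3.summable.prod_factor k).hasSum)
    have h5 : binomialTail β a k * f k = ∑' j, G (j, k) := tsum_mul_right.symm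
    rw [h5]
    exact h4
  rwa [h1.unique h] at h2

/-! ### Differentiation of expansions -/

lemma hasSum_of_eq {f g : ℕ → ℂ} {S : ℂ} (h : HasSum f S) (e : ∀ n, g n = f n) : HasSum g S := by
  rwa [funext e]

/-- Termwise differentiation by the Weierstrass test. Phrasing the result through `deriv f` allows a
second application to the differentiated series. -/
lemma hasDerivAt_of_hasSum {a : ℕ → ℂ} (ha : Summable fun n : ℕ => ‖a n‖ * ((n : ℝ) + 1) ^ 2)
    {U : Set ℝ} (hU : IsOpen U) (hU' : IsPreconnected U) {g g' : ℕ → ℝ → ℝ} {B : ℝ}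
    (hg : ∀ n, ∀ y ∈ U, HasDerivAt (g n) (g' n y) y)
    (hB : ∀ n : ℕ, ∀ y ∈ U, |g' n y| ≤ B * ((n : ℝ) + 1) ^ 2) {f : ℝ → ℂ}
    (hf : ∀ y ∈ U, HasSum (fun n => a n * (g n y : ℂ)) (f y)) {y : ℝ} (hy : y ∈ U) :
    HasDerivAt f (deriv f y) y ∧ HasSum (fun n => a n * (g' n y : ℂ)) (deriv f y) := by
  have hbound : ∀ n : ℕ, ∀ z ∈ U, ‖a n * (g' n z : ℂ)‖ ≤ B * (‖a n‖ * ((n : ℝ) + 1) ^ 2) := by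
    intro n z hz
    rw [norm_mul, Complex.norm_real]
    calc ‖a n‖ * ‖g' n z‖ ≤ ‖a n‖ * (B * ((n : ℝ) + 1) ^ 2) := by
          gcongr
          exact hB n z hz
      _ = _ := by ring
  have h := hasDerivAt_tsum_of_isPreconnected (ha.mul_left B) hU hU'
    (fun n z hz => (hg n z hz).ofReal_comp.const_mul (a n)) hbound hy (hf y hy).summable hy
  have he : f =ᶠ[𝓝 y] fun z => ∑' n, a n * (g n z : ℂ) := by
    filter_upwards [hU.mem_nhds hy] with z hz
    exact (hf z hz).tsum_eq.symm
  have h2 := h.congr_of_eventuallyEq he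
  refine ⟨h2.differentiableAt.hasDerivAt, ?_⟩
  rw [h2.deriv]
  exact (Summable.of_norm_bounded (ha.mul_left B) fun n => hbound n y hy).hasSum

lemma isPreconnected_Ioo_real (a b : ℝ) : IsPreconnected (Ioo a b) := (convex_Ioo a b).isPreconnected

lemma hasSum_laguerreOp {a : ℕ → ℂ} (ha : Summable fun n : ℕ => ‖a n‖ * ((n : ℝ) + 1) ^ 2)
    {φ : Ioi (0 : ℝ) → ℂ} (hφ : ∀ x, HasSum (fun n => a n * laguerreFun n x) (φ x)) (ρ c : ℂ)
    (x : Ioi (0 : ℝ)) :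
    HasSum (fun n => (ρ * n + c) * a n * laguerreFun n x) (laguerreOp ρ c φ x) := by
  obtain ⟨x, hx⟩ := x
  have hx' : 0 < x := hx
  -- The derivative bounds e^R (n+1)² are uniform only on bounded intervals.
  have hU : IsOpen (Ioo 0 (x + 1)) := isOpen_Ioo
  have hU' := isPreconnected_Ioo_real 0 (x + 1)
  have hxU : x ∈ Ioo 0 (x + 1) := ⟨hx, by linarith⟩
  have h0 : ∀ y ∈ Ioo 0 (x + 1), HasSum (fun n => a n * (lag n y : ℂ)) (extendZero φ y) := by
    intro y hy
    have := hφ ⟨y, hy.1⟩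
    have e : extendZero φ y = φ ⟨y, hy.1⟩ := Subtype.val_injective.extend_apply φ 0 ⟨y, hy.1⟩
    rw [e]
    exact this
  have h1 : ∀ y ∈ Ioo 0 (x + 1), HasSum (fun n => a n * (lag' n y : ℂ))
      (deriv (extendZero φ) y) := fun y hy =>
    (hasDerivAt_of_hasSum ha hU hU' (fun n y _ => hasDerivAt_lag n y)
      (fun n y hy => lag'_abs_le n hy.1.le hy.2.le) h0 hy).2
  have h2 := (hasDerivAt_of_hasSum ha hU hU' (fun n y _ => hasDerivAt_lag' n y)
      (fun n y hy => lag''_abs_le n hy.1.le hy.2.le) h1 hxU).2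
  have h3 := hφ ⟨x, hx⟩
  have h4 := ((((h2.mul_left (x : ℂ)).add (h1 x hxU)).sub (h3.mul_left ((x : ℂ) / 4))).add
    (h3.mul_left (1 / 2))).neg.mul_left ρ |>.add (h3.mul_left c)
  refine hasSum_of_eq h4 fun n => ?_
  have h6 := congrArg (fun t : ℝ => (t : ℂ)) (lag_ode n x)
  have h7 : laguerreFun n ⟨x, hx⟩ = (lag n x : ℂ) := rfl
  rw [h7]
  push_cast at h6 ⊢
  linear_combination (ρ * a n) * h6

/-- For w(r) = φ(r²) the chain rule gives w'' + w'/r = 4 (x φ'' + φ') at x = r², so J w(r) = (E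
φ)(r²). Working term by term avoids differentiating φ at the end point 0. -/
lemma hasSum_radialOp {a : ℕ → ℂ} (ha : Summable fun n : ℕ => ‖a n‖ * ((n : ℝ) + 1) ^ 2)
    {ψ : ℝ → ℂ} (hψ : ∀ y, HasSum (fun n => a n * (lag n (y ^ 2) : ℂ)) (ψ y)) :
    Continuous ψ ∧ ∀ (ρ c : ℂ) (r : ℝ),
      HasSum (fun n => (ρ * n + c) * a n * (lag n (r ^ 2) : ℂ)) (radialOp ρ c ψ r) := by
  have hd0 : ∀ n y, HasDerivAt (fun y => lag n (y ^ 2)) (2 * y * lag' n (y ^ 2)) y := by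
    intro n y
    have := (hasDerivAt_lag n (y ^ 2)).comp y (hasDerivAt_pow 2 y)
    refine this.congr_deriv ?_
    simp
    ring
  have hd1 : ∀ n y, HasDerivAt (fun y => 2 * y * lag' n (y ^ 2))
      (2 * lag' n (y ^ 2) + 4 * y ^ 2 * lag'' n (y ^ 2)) y := by
    intro n y
    have := ((hasDerivAt_id y).const_mul 2).mul
      ((hasDerivAt_lag' n (y ^ 2)).comp y (hasDerivAt_pow 2 y))
    refine this.congr_deriv ?_
    simp
    ring
  have key : ∀ y : ℝ, HasDerivAt ψ (deriv ψ y) y ∧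
      HasSum (fun n => a n * ((2 * y * lag' n (y ^ 2) : ℝ) : ℂ)) (deriv ψ y) ∧
      HasSum (fun n => a n * ((2 * lag' n (y ^ 2) + 4 * y ^ 2 * lag'' n (y ^ 2) : ℝ) : ℂ))
        (deriv (deriv ψ) y) := by
    intro y
    set R := |y| + 1 with hR
    have hR0 : 0 < R := by positivity
    have hU : IsOpen (Ioo (-R) R) := isOpen_Ioo
    have hU' := isPreconnected_Ioo_real (-R) R
    have hyU : y ∈ Ioo (-R) R := abs_lt.1 (by linarith)
    have hb : ∀ z ∈ Ioo (-R) R, |z| ≤ R ∧ z ^ 2 ≤ R ^ 2 := fun z hz =>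
      ⟨(abs_lt.2 hz).le, sq_le_sq' hz.1.le hz.2.le⟩
    have h1 : ∀ z ∈ Ioo (-R) R, HasDerivAt ψ (deriv ψ z) z ∧
        HasSum (fun n => a n * ((2 * z * lag' n (z ^ 2) : ℝ) : ℂ)) (deriv ψ z) := fun z hz => by
      refine hasDerivAt_of_hasSum (B := 2 * R * Real.exp (R ^ 2)) ha hU hU' (fun n z _ => hd0 n z)
        (fun n z hz => ?_) (fun z _ => hψ z) hz
      have := lag'_abs_le n (sq_nonneg z) (hb z hz).2
      rw [abs_mul, abs_mul, abs_two, mul_assoc (2 * R)]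
      gcongr
      exact (hb z hz).1
    refine ⟨(h1 y hyU).1, (h1 y hyU).2, ?_⟩
    refine (hasDerivAt_of_hasSum (B := (2 + 4 * R ^ 2) * Real.exp (R ^ 2)) ha hU hU'
      (fun n z _ => hd1 n z) (fun n z hz => ?_) (fun z hz => (h1 z hz).2) hyU).2
    have e1 := lag'_abs_le n (sq_nonneg z) (hb z hz).2
    have e2 := lag''_abs_le n (sq_nonneg z) (hb z hz).2
    refine (abs_add_le _ _).trans ?_
    rw [abs_mul, abs_mul, abs_mul, abs_two, abs_of_nonneg (sq_nonneg z),
      abs_of_pos (by norm_num : (0 : ℝ) < 4), mul_assoc (2 + 4 * R ^ 2), add_mul]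
    exact add_le_add (by gcongr)
      (mul_le_mul (by linarith [(hb z hz).2]) e2 (abs_nonneg _) (by positivity))
  refine ⟨continuous_iff_continuousAt.2 fun y => (key y).1.continuousAt, fun ρ c r => ?_⟩
  obtain ⟨-, h1, h2⟩ := key r
  have h3 := hψ r
  -- Termwise w'/r is 2 l_n'(r²). At r = 0 this equals the second derivative, whose other term
  -- carries the factor r².
  have h4 : HasSum (fun n => a n * ((2 * lag' n (r ^ 2) : ℝ) : ℂ))
      (if r = 0 then deriv (deriv ψ) 0 else deriv ψ r / (r : ℂ)) := by
    split_ifs with hr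
    · subst hr
      simpa using h2
    · have hr' : (r : ℂ) ≠ 0 := by exact_mod_cast hr
      refine hasSum_of_eq (h1.div_const (r : ℂ)) fun n => ?_
      push_cast
      field_simp
  have h5 := (((h2.add h4).sub (h3.mul_left ((r : ℂ) ^ 2))).mul_left (-(ρ / 4))).sub
    (h3.mul_left (ρ / 2 - c))
  refine hasSum_of_eq h5 fun n => ?_
  have h6 := congrArg (fun t : ℝ => (t : ℂ)) (lag_ode n (r ^ 2))
  push_cast at h6 ⊢
  linear_combination (ρ * a n) * h6

/-! ### Continuous maps between spaces of expansions -/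

lemma MemEll.roumieu {k : Kind} {s : ℝ} {a : ℕ → ℂ} (h : MemEll k s a) : MemEll .roumieu s a :=
  h.exists_weightedBound

/-- The pullback of an admissible seminorm is admissible: in the Roumieu case every r is sent to θr,
in the Beurling case the given r is reached from r/θ. -/
lemma continuous_of_stepBound {X Y : Type} {e : ℕ → X → ℂ} {e' : ℕ → Y → ℂ} {k : Kind} {s : ℝ}
    (f : ExpansionSpace e k s →ₗ[ℂ] ExpansionSpace e' k s)
    (hf : ∃ θ : ℝ, 0 < θ ∧ ∀ r : ℝ, 0 < r → ∃ C : ℝ, ∀ φ M,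
      StepBound r M φ → StepBound (θ * r) (C * M) (f φ)) : Continuous f := by
  refine (withSeminorms e k s).continuous_of_isBounded (withSeminorms e' k s) f fun ⟨p, hp⟩ => ?_
  obtain ⟨θ, hθ, h⟩ := hf
  have hadm : IsAdmissible (p.comp f) := by
    cases k with
    | roumieu =>
      intro r hr
      obtain ⟨C, hC⟩ := h r hr
      obtain ⟨C', hC'⟩ := hp (θ * r) (mul_pos hθ hr)
      refine ⟨C' * C, fun φ M hφ => ?_⟩
      rw [mul_assoc]
      exact hC' _ _ (hC φ M hφ)
    | beurling =>
      obtain ⟨r, hr, C', hC'⟩ := hp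
      obtain ⟨C, hC⟩ := h (r / θ) (div_pos hr hθ)
      rw [mul_div_cancel₀ r hθ.ne'] at hC
      refine ⟨r / θ, div_pos hr hθ, C' * C, fun φ M hφ => ?_⟩
      rw [mul_assoc]
      exact hC' _ _ (hC φ M hφ)
  refine ⟨{⟨p.comp f, hadm⟩}, 1, ?_⟩
  rw [Finset.sup_singleton, one_smul]
  exact le_rfl

/-- The linear map given by a transformation of functions that acts on the expansion
coefficients by a transfer operator. -/
def expansionLinearMap {X Y : Type} {e : ℕ → X → ℂ} {e' : ℕ → Y → ℂ} {k : Kind} {s : ℝ}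
    (F : (X → ℂ) → Y → ℂ) {T : (ℕ → ℂ) → ℕ → ℂ} (hT : IsTransfer s T)
    (hF : ∀ a φ, MemEll .roumieu s a → (∀ x, HasSum (fun n => a n * e n x) (φ x)) →
      ∀ y, HasSum (fun n => T a n * e' n y) (F φ y))
    (hadd : ∀ φ ∈ expansionSubmodule e .roumieu s, ∀ χ ∈ expansionSubmodule e .roumieu s,
      F (φ + χ) = F φ + F χ)
    (hsmul : ∀ (c : ℂ), ∀ φ ∈ expansionSubmodule e .roumieu s, F (c • φ) = c • F φ) :
    ExpansionSpace e k s →ₗ[ℂ] ExpansionSpace e' k s where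
  toFun φ := ⟨F φ.1, by
    obtain ⟨a, ha, h⟩ := φ.2
    exact ⟨T a, hT.memEll ha, hF a φ.1 ha.roumieu h⟩⟩
  map_add' φ χ := by
    obtain ⟨a, ha, h⟩ := φ.2
    obtain ⟨b, hb, h'⟩ := χ.2
    exact Subtype.ext (hadd φ.1 ⟨a, ha.roumieu, h⟩ χ.1 ⟨b, hb.roumieu, h'⟩)
  map_smul' c φ := by
    obtain ⟨a, ha, h⟩ := φ.2
    exact Subtype.ext (hsmul c φ.1 ⟨a, ha.roumieu, h⟩)

/-- The map `expansionLinearMap` is continuous. -/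
def expansionMap {X Y : Type} {e : ℕ → X → ℂ} {e' : ℕ → Y → ℂ} {k : Kind} {s : ℝ}
    (F : (X → ℂ) → Y → ℂ) {T : (ℕ → ℂ) → ℕ → ℂ} (hT : IsTransfer s T)
    (hF : ∀ a φ, MemEll .roumieu s a → (∀ x, HasSum (fun n => a n * e n x) (φ x)) →
      ∀ y, HasSum (fun n => T a n * e' n y) (F φ y))
    (hadd : ∀ φ ∈ expansionSubmodule e .roumieu s, ∀ χ ∈ expansionSubmodule e .roumieu s,
      F (φ + χ) = F φ + F χ)
    (hsmul : ∀ (c : ℂ), ∀ φ ∈ expansionSubmodule e .roumieu s, F (c • φ) = c • F φ) :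
    ExpansionSpace e k s →L[ℂ] ExpansionSpace e' k s :=
  ⟨expansionLinearMap F hT hF hadd hsmul, by
    refine continuous_of_stepBound _ ?_
    obtain ⟨θ, hθ, h⟩ := hT
    refine ⟨θ, hθ, fun r hr => ?_⟩
    obtain ⟨C, hC⟩ := h r hr
    -- The sequence in `StepBound` is controlled for a single index r even in the Beurling case;
    -- this is why `hF` is required for all Roumieu sequences.
    exact ⟨C, fun φ M ⟨a, ha, hφ⟩ => ⟨T a, hC M a ha, hF a φ.1 ⟨r, hr, M, ha⟩ hφ⟩⟩⟩

/-! ### The Laguerre operator on the test space -/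

lemma isTransfer_laguerreOp {s : ℝ} (hs : 0 < s) (ρ c : ℂ) :
    IsTransfer s (fun a n => (ρ * (n : ℂ) + c) * a n) := by
  refine isTransfer_diagonal (K := ‖ρ‖ + ‖c‖) (j := 1) hs fun n => ?_
  refine (norm_add_le _ _).trans ?_
  rw [norm_mul, Complex.norm_natCast, pow_one]
  have h1 : 0 ≤ ‖c‖ * n := by positivity
  have h2 := norm_nonneg ρ
  linarith

/-- The operator `E_{ρ,c}` on the test space. -/
def laguerreOpCLM (k : Kind) {α : ℝ} (hα : 0 < α) (ρ c : ℂ) :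
    LaguerreSpace k α →L[ℂ] LaguerreSpace k α :=
  expansionMap (laguerreOp ρ c) (isTransfer_laguerreOp (half_pos hα) ρ c)
    (fun _ _ ha h => hasSum_laguerreOp (ha.summable (half_pos hα) 2) h ρ c)
    (by
      rintro φ ⟨a, ha, hφ⟩ χ ⟨b, hb, hχ⟩
      ext x
      have h1 := hasSum_laguerreOp (ha.summable (half_pos hα) 2) hφ ρ c x
      have h2 := hasSum_laguerreOp (hb.summable (half_pos hα) 2) hχ ρ c x
      have h3 := hasSum_laguerreOp ((ha.add hb).summable (half_pos hα) 2) (φ := φ + χ)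
        (fun x => hasSum_of_eq ((hφ x).add (hχ x)) fun n => by simp [add_mul]) ρ c x
      exact h3.unique (hasSum_of_eq (h1.add h2) fun n => by simp [mul_add, add_mul]))
    (by
      rintro d φ ⟨a, ha, hφ⟩
      ext x
      have h1 := hasSum_laguerreOp (ha.summable (half_pos hα) 2) hφ ρ c x
      have h3 := hasSum_laguerreOp ((ha.smul d).summable (half_pos hα) 2) (φ := d • φ)
        (fun x => hasSum_of_eq ((hφ x).mul_left d) fun n => by simp [mul_assoc]) ρ c x
      exact h3.unique (hasSum_of_eq (h1.mul_left d) fun n => by simp; ring))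

lemma isLaguerreOp_laguerreOpCLM (k : Kind) {α : ℝ} (hα : 0 < α) (ρ c : ℂ) :
    IsLaguerreOp ρ c (laguerreOpCLM k hα ρ c) := fun _ _ => rfl

lemma laguerreOpCLM_laguerreElement (k : Kind) {α : ℝ} (hα : 0 < α) (ρ c : ℂ) (n : ℕ) :
    laguerreOpCLM k hα ρ c (laguerreElement k α n) =
      (ρ * (n : ℂ) + c) • laguerreElement k α n := by
  refine Subtype.ext (funext fun x => ?_)
  have hs : ∀ x, HasSum (fun m => (Pi.single n 1 : ℕ → ℂ) m * laguerreFun m x)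
      (laguerreFun n x) := by
    intro x
    have := hasSum_single (f := fun m => (Pi.single n 1 : ℕ → ℂ) m * laguerreFun m x) n
      fun m hm => by simp [hm]
    simpa using this
  have h := hasSum_laguerreOp ((memEll_single k (α / 2) n).summable (half_pos hα) 2) hs ρ c x
  refine h.unique (hasSum_of_eq ((hs x).mul_left (ρ * (n : ℂ) + c)) fun m => ?_)
  by_cases hm : m = n
  · subst hm; simp
  · simp [hm]

/-! ### The change of variables -/

lemma summable_mul_lag {a : ℕ → ℂ} {s : ℝ} (hs : 0 < s) (ha : MemEll .roumieu s a) (y : ℝ) :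
    Summable fun n => a n * (lag n (y ^ 2) : ℂ) := by
  refine Summable.of_norm_bounded ((ha.summable hs 0).mul_right (Real.exp (y ^ 2))) fun n => ?_
  rw [norm_mul, Complex.norm_real, pow_zero, mul_one]
  gcongr
  exact lag_abs_le n (sq_nonneg y) le_rfl

/-- The even function `ψ` on `ℝ` with `ψ(y) = φ(y²)`, defined at `y = 0` by a limit. -/
def squareChange (φ : Ioi (0 : ℝ) → ℂ) (y : ℝ) : ℂ :=
  limUnder (comap Subtype.val (𝓝 (y ^ 2))) φ

instance neBot_comap_nhds_sq (y : ℝ) :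
    NeBot (comap (Subtype.val : Ioi (0 : ℝ) → ℝ) (𝓝 (y ^ 2))) := by
  rw [← mem_closure_iff_comap_neBot, closure_Ioi]
  exact sq_nonneg y

/-- The series in l_n(y²) has a continuous sum ψ, also at y = 0, and φ(x) = ψ(√x); so the defining
limit exists and is ψ(y). The convergence statement later yields linearity, by uniqueness of limits.
-/
lemma squareChange_spec {a : ℕ → ℂ} {s : ℝ} (hs : 0 < s) (ha : MemEll .roumieu s a)
    {φ : Ioi (0 : ℝ) → ℂ} (hφ : ∀ x, HasSum (fun n => a n * laguerreFun n x) (φ x)) (y : ℝ) :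
    HasSum (fun n => a n * (lag n (y ^ 2) : ℂ)) (squareChange φ y) ∧
      Tendsto φ (comap Subtype.val (𝓝 (y ^ 2))) (𝓝 (squareChange φ y)) := by
  set ψ : ℝ → ℂ := fun y => ∑' n, a n * (lag n (y ^ 2) : ℂ) with hψ
  have h : ∀ y, HasSum (fun n => a n * (lag n (y ^ 2) : ℂ)) (ψ y) := fun y =>
    (summable_mul_lag hs ha y).hasSum
  have hc : Continuous ψ := (hasSum_radialOp (ha.summable hs 2) h).1
  have h1 : φ = fun x : Ioi (0 : ℝ) => ψ (Real.sqrt x) := by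
    ext x
    have := h (Real.sqrt x)
    rw [Real.sq_sqrt (le_of_lt x.2)] at this
    exact (hφ x).unique this
  have h2 : ψ (Real.sqrt (y ^ 2)) = ψ y := by
    rw [Real.sqrt_sq_eq_abs]
    simp only [hψ, sq_abs]
  have h3 : Tendsto φ (comap Subtype.val (𝓝 (y ^ 2))) (𝓝 (ψ y)) := by
    rw [← h2, h1]
    exact ((hc.comp Real.continuous_sqrt).tendsto (y ^ 2)).comp tendsto_comap
  have h4 : squareChange φ y = ψ y := h3.limUnder_eq
  rw [h4]
  exact ⟨h y, h3⟩

/-- The action of the change of variables `φ ↦ φ(y²)` on coefficients. -/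
def squareCoeff (a : ℕ → ℂ) : ℕ → ℂ :=
  spread fun m => (((hermiteNorm m)⁻¹ : ℝ) : ℂ) * binomialTail (1 / 2) a m

lemma isTransfer_squareCoeff {s : ℝ} (hs : 0 < s) : IsTransfer s squareCoeff := by
  refine (isTransfer_spread s).comp ((isTransfer_diagonal (K := 2) (j := 0) hs
    (d := fun m => (((hermiteNorm m)⁻¹ : ℝ) : ℂ)) fun n => ?_).comp
      (isTransfer_binomialTail (β := 1 / 2) hs (by norm_num [abs_le])))
  rw [Complex.norm_real, pow_zero, mul_one]
  exact hermiteNorm_inv_abs_le n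

lemma hasSum_even_iff {f : ℕ → ℂ} {S : ℂ} (hf : ∀ n, ¬ Even n → f n = 0) :
    HasSum (fun m => f (2 * m)) S ↔ HasSum f S := by
  refine Function.Injective.hasSum_iff (f := f) (mul_right_injective₀ (two_ne_zero' ℕ)) ?_
  intro n hn
  refine hf n fun h => hn ?_
  obtain ⟨m, rfl⟩ := h.exists_two_nsmul
  exact ⟨m, rfl⟩

lemma hasSum_squareCoeff {s : ℝ} (hs : 0 < s) {a : ℕ → ℂ} (ha : MemEll .roumieu s a) {y : ℝ}
    {S : ℂ} (h : HasSum (fun n => a n * (lag n (y ^ 2) : ℂ)) S) :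
    HasSum (fun n => squareCoeff a n * hermiteFun n y) S := by
  obtain ⟨D, hD⟩ := ha.exists_pow_bound hs 5
  rw [← hasSum_even_iff fun n hn => by rw [squareCoeff, spread_of_odd _ hn, zero_mul]]
  have h2 := hasSum_binomialTail (β := 1 / 2) (f := fun k => (evenHerm k y : ℂ))
    (F := Real.exp (y ^ 2)) (S := S) (by norm_num [abs_le]) hD
    (fun k => by rw [Complex.norm_real]; exact evenHerm_abs_le k y)
    (hasSum_of_eq h fun n => by rw [lag_sq_eq, ofReal_binomialConv])
  refine hasSum_of_eq h2 fun m => ?_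
  have hm : (hermiteNorm m : ℂ) ≠ 0 := by exact_mod_cast hermiteNorm_ne_zero m
  rw [squareCoeff, spread_two_mul, hermiteFun_even]
  push_cast
  field_simp

/-- The change of variables `φ ↦ φ(y²)` as a continuous linear map. -/
def squareChangeCLM (k : Kind) {α : ℝ} (hα : 0 < α) :
    LaguerreSpace k α →L[ℂ] HermiteSpace k (α / 2) :=
  expansionMap squareChange (isTransfer_squareCoeff (half_pos hα))
    (fun _ _ ha h y => hasSum_squareCoeff (half_pos hα) ha
      (squareChange_spec (half_pos hα) ha h y).1)
    (by
      rintro φ ⟨a, ha, hφ⟩ χ ⟨b, hb, hχ⟩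
      ext y
      exact ((squareChange_spec (half_pos hα) ha hφ y).2.add
        (squareChange_spec (half_pos hα) hb hχ y).2).limUnder_eq)
    (by
      rintro d φ ⟨a, ha, hφ⟩
      ext y
      exact ((squareChange_spec (half_pos hα) ha hφ y).2.const_smul d).limUnder_eq)

/-- The change of variables `φ ↦ φ(y²)` with values in the even functions. -/
def squareChangeEven (k : Kind) {α : ℝ} (hα : 0 < α) :
    LaguerreSpace k α →L[ℂ] EvenHermiteSpace k (α / 2) :=
  (squareChangeCLM k hα).codRestrict (evenHermite k (α / 2)) fun φ y => by
    change squareChange φ.1 (-y) = squareChange φ.1 y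
    rw [squareChange, neg_sq, squareChange]

/-- The action of the change of variables `ψ ↦ ψ(√x)` on coefficients. -/
def sqrtCoeff (b : ℕ → ℂ) : ℕ → ℂ :=
  binomialTail (-1 / 2) fun m => (hermiteNorm m : ℂ) * b (2 * m)

lemma isTransfer_sqrtCoeff_aux {s : ℝ} (hs : 0 < s) :
    IsTransfer s fun b m => (hermiteNorm m : ℂ) * b (2 * m) := by
  refine (isTransfer_diagonal (K := 2) (j := 1) hs
    (d := fun m => (hermiteNorm m : ℂ)) fun n => ?_).comp (isTransfer_even hs)
  rw [Complex.norm_real, pow_one]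
  exact hermiteNorm_abs_le n

lemma isTransfer_sqrtCoeff {s : ℝ} (hs : 0 < s) : IsTransfer s sqrtCoeff :=
  (isTransfer_binomialTail (β := -1 / 2) hs (by norm_num [abs_le])).comp
    (isTransfer_sqrtCoeff_aux hs)

/-- Averaging over ±y cancels the odd Hermite terms, so they may be dropped without knowing that an
even function has vanishing odd coefficients. -/
lemma hasSum_sqrtCoeff {s : ℝ} (hs : 0 < s) {b : ℕ → ℂ} (hb : MemEll .roumieu s b) {ψ : ℝ → ℂ}
    (h : ∀ y, HasSum (fun n => b n * hermiteFun n y) (ψ y)) (y : ℝ) :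
    HasSum (fun n => sqrtCoeff b n * (lag n (y ^ 2) : ℂ)) ((ψ y + ψ (-y)) / 2) := by
  obtain ⟨D, hD⟩ := ((isTransfer_sqrtCoeff_aux hs).memEll hb).exists_pow_bound hs 5
  have h1 := ((h y).add (h (-y))).div_const 2
  rw [← hasSum_even_iff] at h1
  · refine hasSum_binomialTail (β := -1 / 2) (f := fun k => (lag k (y ^ 2) : ℂ))
      (F := Real.exp (y ^ 2)) (by norm_num [abs_le]) hD (fun k => ?_)
      (hasSum_of_eq h1 fun m => ?_)
    · rw [Complex.norm_real]
      refine (lag_abs_le k (sq_nonneg y) le_rfl).trans (le_mul_of_one_le_right ?_ ?_)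
      · positivity
      · linarith [(Nat.cast_nonneg k : (0 : ℝ) ≤ k)]
    · rw [← ofReal_binomialConv, ← evenHerm_eq, hermiteFun_neg, hermiteFun_even, pow_mul]
      push_cast
      simp
      ring
  · intro n hn
    rw [hermiteFun_neg, (Nat.not_even_iff_odd.1 hn).neg_one_pow]
    ring

/-- The map `ψ ↦ (ψ(√x) + ψ(-√x)) / 2` as a continuous linear map. -/
def sqrtChangeCLM (k : Kind) {α : ℝ} (hα : 0 < α) :
    HermiteSpace k (α / 2) →L[ℂ] LaguerreSpace k α :=
  expansionMap (fun ψ x => (ψ (Real.sqrt x) + ψ (-Real.sqrt x)) / 2)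
    (isTransfer_sqrtCoeff (half_pos hα))
    (fun b ψ hb h x => by
      have := hasSum_sqrtCoeff (half_pos hα) hb h (Real.sqrt x)
      rw [Real.sq_sqrt (le_of_lt x.2)] at this
      exact this)
    (fun φ _ χ _ => by ext x; simp; ring)
    (fun c φ _ => by ext x; simp; ring)

/-- The change of variables `ψ ↦ ψ(√x)` on the even functions. -/
def sqrtChangeEven (k : Kind) {α : ℝ} (hα : 0 < α) :
    EvenHermiteSpace k (α / 2) →L[ℂ] LaguerreSpace k α :=
  (sqrtChangeCLM k hα).comp (evenHermite k (α / 2)).subtypeL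

lemma sqrtChangeEven_apply (k : Kind) {α : ℝ} (hα : 0 < α) (ψ : EvenHermiteSpace k (α / 2))
    (x : Ioi (0 : ℝ)) : (sqrtChangeEven k hα ψ) x = ψ.1 (Real.sqrt x) := by
  change (ψ.1.1 (Real.sqrt x) + ψ.1.1 (-Real.sqrt x)) / 2 = ψ.1.1 (Real.sqrt x)
  have h : ψ.1.1 (-Real.sqrt x) = ψ.1.1 (Real.sqrt x) := ψ.2 _
  rw [h]
  ring

/-- This replaces Hermite expansions of even functions by expansions in l_n(y²), in which both the
inverse of 𝒥 and the operator J are checked. -/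
lemma exists_coeff_of_even {k : Kind} {s : ℝ} (hs : 0 < s) (ψ : EvenHermiteSpace k s) :
    ∃ a : ℕ → ℂ, MemEll .roumieu s a ∧
      ∀ y, HasSum (fun n => a n * (lag n (y ^ 2) : ℂ)) (ψ.1.1 y) := by
  obtain ⟨b, hb, h⟩ := ψ.1.2
  refine ⟨sqrtCoeff b, (isTransfer_sqrtCoeff hs).memEll hb.roumieu, fun y => ?_⟩
  have h1 := hasSum_sqrtCoeff hs hb.roumieu h y
  have h2 : ψ.1.1 (-y) = ψ.1.1 y := ψ.2 y
  rwa [h2, add_self_div_two] at h1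

lemma hasSum_sqrtChangeEven {k : Kind} {α : ℝ} (hα : 0 < α) {ψ : EvenHermiteSpace k (α / 2)}
    {a : ℕ → ℂ} (h : ∀ y, HasSum (fun n => a n * (lag n (y ^ 2) : ℂ)) (ψ.1.1 y))
    (x : Ioi (0 : ℝ)) :
    HasSum (fun n => a n * laguerreFun n x) ((sqrtChangeEven k hα ψ) x) := by
  have := h (Real.sqrt x)
  rw [Real.sq_sqrt (le_of_lt x.2)] at this
  rw [sqrtChangeEven_apply]
  exact this

/-- One coefficient sequence serves ψ, 𝒥ψ and the function recovered from it, and a series has only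
one sum. -/
lemma squareChangeEven_sqrtChangeEven (k : Kind) {α : ℝ} (hα : 0 < α)
    (ψ : EvenHermiteSpace k (α / 2)) : squareChangeEven k hα (sqrtChangeEven k hα ψ) = ψ := by
  obtain ⟨a, ha, h⟩ := exists_coeff_of_even (half_pos hα) ψ
  refine Subtype.ext (Subtype.ext (funext fun y => ?_))
  exact (squareChange_spec (half_pos hα) ha (hasSum_sqrtChangeEven hα h) y).1.unique (h y)

lemma sqrtChangeEven_squareChangeEven (k : Kind) {α : ℝ} (hα : 0 < α)
    (φ : LaguerreSpace k α) : sqrtChangeEven k hα (squareChangeEven k hα φ) = φ := by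
  obtain ⟨a, ha, h⟩ := φ.2
  refine Subtype.ext (funext fun x => ?_)
  refine (sqrtChangeEven_apply k hα _ x).trans ?_
  have h1 := (squareChange_spec (half_pos hα) ha.roumieu h (Real.sqrt x)).1
  rw [Real.sq_sqrt (le_of_lt x.2)] at h1
  exact h1.unique (h x)

/-- The change of variables `(𝒥 ψ)(x) = ψ(√x)` as a topological isomorphism. -/
def sqrtChange (k : Kind) {α : ℝ} (hα : 0 < α) :
    EvenHermiteSpace k (α / 2) ≃L[ℂ] LaguerreSpace k α :=
  ContinuousLinearEquiv.equivOfInverse (sqrtChangeEven k hα) (squareChangeEven k hα)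
    (squareChangeEven_sqrtChangeEven k hα) (sqrtChangeEven_squareChangeEven k hα)

/-- The operator `J_{ρ,c}` on the even functions, `J_{ρ,c} = 𝒥⁻¹ E_{ρ,c} 𝒥`. -/
def radialOpCLM (k : Kind) {α : ℝ} (hα : 0 < α) (ρ c : ℂ) :
    EvenHermiteSpace k (α / 2) →L[ℂ] EvenHermiteSpace k (α / 2) :=
  (squareChangeEven k hα).comp ((laguerreOpCLM k hα ρ c).comp (sqrtChangeEven k hα))

/-- The conjugate of E and the differential expression J are both sums of the series with
coefficients (ρn + c) a_n in l_n(r²). -/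
lemma isRadialOp_radialOpCLM (k : Kind) {α : ℝ} (hα : 0 < α) (ρ c : ℂ) :
    IsRadialOp ρ c (radialOpCLM k hα ρ c) := by
  intro ψ r
  obtain ⟨a, ha, h⟩ := exists_coeff_of_even (half_pos hα) ψ
  have h1 := hasSum_laguerreOp (ha.summable (half_pos hα) 2) (hasSum_sqrtChangeEven hα h) ρ c
  have h2 := (squareChange_spec (half_pos hα)
    ((isTransfer_laguerreOp (half_pos hα) ρ c).memEll ha) h1 r).1
  exact h2.unique ((hasSum_radialOp (ha.summable (half_pos hα) 2) h).2 ρ c r)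

/-! ### Intertwining and transport of solutions -/

lemma sqrtChange_radialOpCLM (k : Kind) {α : ℝ} (hα : 0 < α) (ρ c : ℂ)
    (ψ : EvenHermiteSpace k (α / 2)) :
    sqrtChange k hα (radialOpCLM k hα ρ c ψ) = laguerreOpCLM k hα ρ c (sqrtChange k hα ψ) :=
  sqrtChangeEven_squareChangeEven k hα _

/-- The transpose of 𝒥 B = A 𝒥, tested on an even function. -/
lemma transposeEquiv_intertwines {k : Kind} {α : ℝ} (hα : 0 < α) (ρ c : ℂ)
    (f : StrongDual ℂ (LaguerreSpace k α)) :
    transposeEquiv (sqrtChange k hα) (transpose (laguerreOpCLM k hα ρ c) f) =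
      transpose (radialOpCLM k hα ρ c) (transposeEquiv (sqrtChange k hα) f) := by
  ext ψ
  rw [transposeEquiv_apply, transpose_apply, transpose_apply, transposeEquiv_apply,
    sqrtChange_radialOpCLM]

/-- A continuous linear map that intertwines two operators maps solutions of the Cauchy problem to
solutions. -/
lemma SolvesCauchy.map {V W : Type} [AddCommGroup V] [Module ℂ V] [TopologicalSpace V]
    [AddCommGroup W] [Module ℂ W] [TopologicalSpace W] {T : ℝ} {L : V → V} {L' : W → W}
    {u : ℝ → V} {f : V} (h : SolvesCauchy T L u f) (Φ : V →L[ℂ] W)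
    (hΦ : ∀ v, Φ (L v) = L' (Φ v)) : SolvesCauchy T L' (fun t => Φ (u t)) (Φ f) := by
  refine ⟨congrArg Φ h.1, fun t ht => ?_⟩
  obtain ⟨u', hu', hL⟩ := h.2 t ht
  refine ⟨Φ u', ?_, ?_⟩
  · have := (Φ.continuous.tendsto u').comp hu'
    simpa only [Function.comp_def, map_smul, map_sub] using this
  · rw [← hΦ, ← map_smul, ← map_sub, hL, map_zero]

end LaguerreCauchy
end

open LaguerreCauchy
theorem proposition5p5 (k : Kind) (α : ℝ) (hα : 0 < α) :
    ∃ 𝒥 : EvenHermiteSpace k (α / 2) ≃L[ℂ] LaguerreSpace k α, IsSqrtChange 𝒥 ∧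
      ∀ ρ c : ℂ, ρ ≠ 0 →
        ∃ (A : LaguerreSpace k α →L[ℂ] LaguerreSpace k α)
          (B : EvenHermiteSpace k (α / 2) →L[ℂ] EvenHermiteSpace k (α / 2)),
          IsLaguerreOp ρ c A ∧ IsRadialOp ρ c B ∧
          (∀ (f : StrongDual ℂ (LaguerreSpace k α)) (n : ℕ),
            transpose A f (laguerreElement k α n) =
              (ρ * (n : ℂ) + c) * f (laguerreElement k α n)) ∧
          ∀ T : ℝ, 0 < T →
            (∀ (f : StrongDual ℂ (LaguerreSpace k α)) (u : ℝ → StrongDual ℂ (LaguerreSpace k α)),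
              SolvesCauchy T (transpose A) u f →
                SolvesCauchy T (transpose B) (fun t => transposeEquiv 𝒥 (u t))
                  (transposeEquiv 𝒥 f)) ∧
            (∀ (g : StrongDual ℂ (EvenHermiteSpace k (α / 2)))
              (v : ℝ → StrongDual ℂ (EvenHermiteSpace k (α / 2))),
              SolvesCauchy T (transpose B) v g →
                SolvesCauchy T (transpose A) (fun t => (transposeEquiv 𝒥).symm (v t))
                  ((transposeEquiv 𝒥).symm g)) := by
  refine ⟨sqrtChange k hα, sqrtChangeEven_apply k hα, fun ρ c _ =>
    ⟨laguerreOpCLM k hα ρ c, radialOpCLM k hα ρ c, isLaguerreOp_laguerreOpCLM k hα ρ c,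
      isRadialOp_radialOpCLM k hα ρ c, fun f n => ?_, fun T _ => ⟨fun f u hu => ?_,
        fun g v hv => ?_⟩⟩⟩
  · rw [transpose_apply, laguerreOpCLM_laguerreElement, map_smul, smul_eq_mul]
  · exact hu.map (transposeEquiv (sqrtChange k hα) :
      StrongDual ℂ (LaguerreSpace k α) →L[ℂ] StrongDual ℂ (EvenHermiteSpace k (α / 2)))
      (transposeEquiv_intertwines hα ρ c)
  · refine hv.map ((transposeEquiv (sqrtChange k hα)).symm :
      StrongDual ℂ (EvenHermiteSpace k (α / 2)) →L[ℂ] StrongDual ℂ (LaguerreSpace k α))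
      fun w => ?_
    -- The inverse of 𝒥' intertwines as well: apply the injective 𝒥' to both sides and use the
    -- relation already proved.
    refine (transposeEquiv (sqrtChange k hα)).injective ?_
    refine Eq.trans ?_ (transposeEquiv_intertwines hα ρ c _).symm
    simp
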